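/- Let $\Sigma$ be a finite alphabet, let $L\subseteq\Sigma^*$ be an arbitrary language, and let $0<\varepsilon<\frac12$. A *1PFA verifier with two provers* is a probabilistic finite automaton without work tape and with arbitrary real transition probabilities, whose read-only input tape contains the input $w$ between a left and a right end-marker, and whose input head starts on the left end-marker, may stay or move right in each step, and never moves to the left or beyond the right end-marker. Its finite state set consists of reading states (among them the initial state), communicating states, and the two halting states "accept" and "reject". In a reading state, the next state and the head move are chosen at random, depending on the state and the scanned symbol. In a communicating state $s$, it sends a symbol $\tau_{s1}$ to the first and a symbol $\tau_{s2}$ to the second prover, receives from them the symbols $\tau_1$ and $\tau_2$ of the same finite communication alphabet, and enters the state $\delta_c(s,\tau_1,\tau_2)$. Each (computationally unlimited) prover sees only the input and the symbols that the verifier has sent to it, neither the coin tosses of the verifier nor the communication with the other prover. Then $L$ has an interactive proof system with two provers and error bound $\varepsilon$ whose verifier is a 1PFA, in both models of two provers: 1. (Multi-prover model.) There are a 1PFA verifier $V$ and provers $P_1,P_2$ such that every $w\in L$ is accepted by $V$ with probability at least $1-\varepsilon$ when it communicates with $P_1,P_2$, and every $w\notin L$ is rejected by $V$ with probability at least $1-\varepsilon$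 when it communicates with any provers $P_1^*,P_2^*$. 2. (Noisy-oracle model.) There are a 1PFA verifier $V$ and provers $P_1,P_2$ such that on every $w\in\Sigma^*$, when $V$ communicates with $P_1$ and any prover $P_2^*$, or with any prover $P_1^*$ and $P_2$, it accepts with probability at least $1-\varepsilon$ if $w\in L$, and rejects with probability at least $1-\varepsilon$ if $w\notin L$. -/

import Mathlib

open scoped ENNReal

namespace TwoProverIPS

/-- Symbols on the read-only input tape: the two end-markers and the letters of the input. -/
inductive TapeSymbol (α : Type*) where
  | leftEnd : TapeSymbol α
  | letter (a : α) : TapeSymbol α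
  | rightEnd : TapeSymbol α

/-- The input `w`, surrounded by the two end-markers: the left end-marker is in cell `0`, the
letters are in cells `1, …, |w|`, and the right end-marker is in cell `|w| + 1`. -/
def tapeAt {α : Type*} (w : List α) : ℕ → TapeSymbol α
  | 0 => TapeSymbol.leftEnd
  | i + 1 =>
    match w[i]? with
    | some a => TapeSymbol.letter a
    | none => TapeSymbol.rightEnd

/-- Moves of a one-way input head: it never moves to the left. -/
inductive Move where
  | stay : Move
  | right : Move

/-- The head position after a move. -/
def Move.apply : Move → ℕ → ℕ
  | Move.stay, i => i
  | Move.right, i => i + 1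

/-- The states of a verifier: reading states, communicating states, and the two halting states. -/
inductive State (R C : Type) where
  | reading (r : R) : State R C
  | communicating (c : C) : State R C
  | accepting : State R C
  | rejecting : State R C

/-- A one-way probabilistic finite automaton (no work tape, arbitrary real transition
probabilities) that communicates with two provers. -/
structure Verifier (α : Type*) where
  /-- the reading states -/
  R : Type
  /-- the communicating states -/
  C : Type
  /-- the communication alphabet -/
  Υ : Type
  [finite_R : Finite R]
  [finite_C : Finite C]
  [finite_Υ : Finite Υ]
  /-- the initial state, a reading state -/
  start : R
  /-- the transition probabilities in a reading state -/
  δr : R → TapeSymbol α → PMF (State R C × Move)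
  /-- the head does not leave the tape through the right end-marker -/
  δr_rightEnd : ∀ (r : R) (s : State R C), δr r TapeSymbol.rightEnd (s, Move.right) = 0
  /-- the symbol that a communicating state writes on the cell shared with the first prover -/
  send₁ : C → Υ
  /-- the symbol that a communicating state writes on the cell shared with the second prover -/
  send₂ : C → Υ
  /-- the next state, given the replies of the two provers -/
  δc : C → Υ → Υ → State R C

/-- A prover sees the input and the symbols that the verifier has written so far on the
communication cell of this prover (oldest first, the current one last), and replies with a symbol.
It does not see the coin tosses of the verifier or the communication with the other prover. -/
def Prover (α Υ : Type*) := List α → List Υ → Υ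

namespace Verifier

variable {α : Type*}

/-- A configuration: the state, the head position, and the lists of the symbols that have been
sent to the first and to the second prover. -/
structure Config (V : Verifier α) where
  state : State V.R V.C
  pos : ℕ
  sent₁ : List V.Υ
  sent₂ : List V.Υ

/-- The initial configuration: the head is on the left end-marker and nothing has been sent. -/
def init (V : Verifier α) : V.Config where
  state := State.reading V.start
  pos := 0
  sent₁ := []
  sent₂ := []

/-- One step of the computation on the input `w` with the provers `P₁` and `P₂`; halting
configurations do not change any more. -/
noncomputable def step (V : Verifier α) (P₁ P₂ : Prover α V.Υ) (w : List α) (c : V.Config) :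
    PMF V.Config :=
  match c.state with
  | State.reading r =>
      (V.δr r (tapeAt w c.pos)).map fun sd =>
        { state := sd.1, pos := sd.2.apply c.pos, sent₁ := c.sent₁, sent₂ := c.sent₂ }
  | State.communicating k =>
      PMF.pure
        { state := V.δc k (P₁ w (c.sent₁ ++ [V.send₁ k])) (P₂ w (c.sent₂ ++ [V.send₂ k]))
          pos := c.pos
          sent₁ := c.sent₁ ++ [V.send₁ k]
          sent₂ := c.sent₂ ++ [V.send₂ k] }
  | State.accepting => PMF.pure c
  | State.rejecting => PMF.pure c

/-- The distribution of the configuration after `n` steps. -/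
noncomputable def run (V : Verifier α) (P₁ P₂ : Prover α V.Υ) (w : List α) : ℕ → PMF V.Config
  | 0 => PMF.pure V.init
  | n + 1 => (run V P₁ P₂ w n).bind (V.step P₁ P₂ w)

/-- The probability that `w` is accepted, that is, that the accepting state is ever entered: the
supremum (and limit) of the nondecreasing probabilities of having accepted within `n` steps. -/
noncomputable def acceptProb (V : Verifier α) (P₁ P₂ : Prover α V.Υ) (w : List α) : ℝ≥0∞ :=
  ⨆ n : ℕ, (V.run P₁ P₂ w n).toOuterMeasure {c | c.state = State.accepting}

/-- The probability that `w` is rejected, that is, that the rejecting state is ever entered. -/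
noncomputable def rejectProb (V : Verifier α) (P₁ P₂ : Prover α V.Υ) (w : List α) : ℝ≥0∞ :=
  ⨆ n : ℕ, (V.run P₁ P₂ w n).toOuterMeasure {c | c.state = State.rejecting}

/-- `V` verifies `L` with error bound `ε` in the multi-prover model (the provers collaborate:
both are honest or both are cheating). Every member is accepted with probability at least `1 - ε`
when `V` communicates with the honest provers, and every non-member is rejected with probability
at least `1 - ε` when `V` communicates with any two provers. -/
def VerifiesMultiProver (V : Verifier α) (L : Language α) (ε : ℝ) : Prop :=
  (∃ P₁ P₂ : Prover α V.Υ, ∀ w ∈ L, ENNReal.ofReal (1 - ε) ≤ V.acceptProb P₁ P₂ w) ∧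
    ∀ w ∉ L, ∀ P₁ P₂ : Prover α V.Υ, ENNReal.ofReal (1 - ε) ≤ V.rejectProb P₁ P₂ w

/-- With probability at least `1 - ε`, the decision of `V` on `w` is the correct one for `L`. -/
def DecidesCorrectly (V : Verifier α) (L : Language α) (ε : ℝ) (P₁ P₂ : Prover α V.Υ)
    (w : List α) : Prop :=
  (w ∈ L → ENNReal.ofReal (1 - ε) ≤ V.acceptProb P₁ P₂ w) ∧
    (w ∉ L → ENNReal.ofReal (1 - ε) ≤ V.rejectProb P₁ P₂ w)

/-- `V` verifies `L` with error bound `ε` in the noisy-oracle model (the provers oppose each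
other: at least one of them, not known to `V`, is honest). On every input, the decision of `V` is
correct with probability at least `1 - ε` whenever at least one of the provers is the honest one,
whatever the other prover does. -/
def VerifiesNoisyOracle (V : Verifier α) (L : Language α) (ε : ℝ) : Prop :=
  ∃ P₁ P₂ : Prover α V.Υ, ∀ w : List α,
    (∀ P₂' : Prover α V.Υ, V.DecidesCorrectly L ε P₁ P₂' w) ∧
      (∀ P₁' : Prover α V.Υ, V.DecidesCorrectly L ε P₁' P₂ w)

end Verifier

end TwoProverIPS

/-!
Let `p` be the real number whose base-4 digits are all `1` or `2`, the `N`-th one telling whether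
the `N`-th word is in `L`. A machine that counts the heads among `4 ^ (a + N)` tosses of a coin
with bias `p`, where `a` is sufficiently large, can read this digit off the count, by Chebyshev's
inequality. A finite automaton with a queue can compute `N` in unary from the input and then keep
this count.

The verifier simulates such an automaton while both provers store its queue. Each symbol is sent
with a Wegman-Carter authentication tag: a random hash value concealed by a one-time pad. The
verifier cannot remember the pads until the symbol returns, so it entrusts the pads for one prover
to the other one. A prover that changes or reorders symbols has to guess a hash value, and is
caught except with probability `1 / |B|`, where `B` is the group of hash values. If a prover is
caught, the verifier rejects in the multi-prover model, and in the noisy-oracle model it asks the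
other prover, which is then honest, whether the input is in `L`.
-/

namespace TwoProverIPS

section Probability

variable {S T X : Type*}

/-- The expectation of a random variable with values in `[0, ∞]`. -/
noncomputable def expect (μ : PMF S) (g : S → ℝ≥0∞) : ℝ≥0∞ := ∑' x, μ x * g x

theorem expect_const (μ : PMF S) (c : ℝ≥0∞) : expect μ (fun _ => c) = c := by
  rw [expect, ENNReal.tsum_mul_right, μ.tsum_coe, one_mul]

theorem expect_add (μ : PMF S) (f g : S → ℝ≥0∞) :
    expect μ (fun x => f x + g x) = expect μ f + expect μ g := by
  simp_rw [expect, mul_add, ENNReal.tsum_add]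

theorem expect_mono (μ : PMF S) {f g : S → ℝ≥0∞} (h : ∀ x, f x ≤ g x) :
    expect μ f ≤ expect μ g :=
  ENNReal.tsum_le_tsum fun x => mul_le_mul_right (h x) _

theorem expect_bind (μ : PMF S) (f : S → PMF T) (g : T → ℝ≥0∞) :
    expect (μ.bind f) g = expect μ fun x => expect (f x) g := by
  simp_rw [expect, PMF.bind_apply, ← ENNReal.tsum_mul_right, ← ENNReal.tsum_mul_left]
  rw [ENNReal.tsum_comm]
  simp_rw [mul_assoc]

theorem expect_pure (a : S) (g : S → ℝ≥0∞) : expect (PMF.pure a) g = g a := by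
  rw [expect, tsum_eq_single a fun x hx => by simp [hx]]
  simp

theorem expect_map (μ : PMF S) (f : S → T) (g : T → ℝ≥0∞) :
    expect (μ.map f) g = expect μ (g ∘ f) := by
  rw [PMF.map, expect_bind]
  simp_rw [Function.comp_apply, expect_pure]
  rfl

theorem mul_toOuterMeasure_le_expect (μ : PMF S) (g : S → ℝ≥0∞) (c : ℝ≥0∞) :
    c * μ.toOuterMeasure {x | c ≤ g x} ≤ expect μ g := by
  rw [PMF.toOuterMeasure_apply, ← ENNReal.tsum_mul_left]
  refine ENNReal.tsum_le_tsum fun x => ?_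
  by_cases hx : c ≤ g x
  · rw [Set.indicator_of_mem (by exact hx), mul_comm]
    gcongr
  · rw [Set.indicator_of_notMem (by exact hx), mul_zero]
    exact zero_le

theorem toOuterMeasure_bind_le (μ : PMF S) (f : S → PMF T) {E : Set T} {c : ℝ≥0∞}
    (h : ∀ x, (f x).toOuterMeasure E ≤ c) : (μ.bind f).toOuterMeasure E ≤ c := by
  rw [PMF.toOuterMeasure_bind_apply]
  exact (expect_mono μ h).trans (expect_const μ c).le

theorem uniformOfFintype_map_equiv [Fintype S] [Nonempty S] (e : S ≃ S) :
    (PMF.uniformOfFintype S).map e = PMF.uniformOfFintype S := by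
  classical
  ext y
  rw [PMF.map_apply, tsum_eq_single (e.symm y) fun x hx => if_neg fun h => hx (by simp [h])]
  simp

section Iid

variable [Nonempty X]

/-- The distribution of a sequence whose first `n` terms are independent with distribution `ρ`.
The other terms are a fixed arbitrary element, so that the sequences have the same type for
all `n`. -/
noncomputable def iid (ρ : PMF X) : ℕ → PMF (ℕ → X)
  | 0 => PMF.pure fun _ => Classical.arbitrary X
  | n + 1 => (iid ρ n).bind fun f => ρ.map (Function.update f n)

theorem iid_map_of_map_eq {ρ : PMF X} {g : ℕ → X → X} (hg : ∀ t, ρ.map (g t) = ρ) (n : ℕ) :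
    (iid ρ n).map (fun f t => if t < n then g t (f t) else f t) = iid ρ n := by
  induction n with
  | zero => simp [iid, PMF.pure_map]
  | succ n ih =>
    have update_comm (f : ℕ → X) :
        (fun f t => if t < n + 1 then g t (f t) else f t) ∘ Function.update f n =
          Function.update (fun t => if t < n then g t (f t) else f t) n ∘ g n := by
      funext x t
      rcases lt_trichotomy t n with h | rfl | h
      · simp [h, h.ne, h.le]
      · simp
      · simp [h.ne', h.not_gt, h.not_ge]
    conv_rhs => rw [iid, ← ih]
    rw [iid, PMF.map_bind, PMF.bind_map]
    refine congrArg _ (funext fun f => ?_)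
    rw [PMF.map_comp, update_comm, ← PMF.map_comp, hg]
    rfl

end Iid

/-- The toss of a coin that shows heads (`true`) with probability `p`. -/
noncomputable def coin (p : unitInterval) : PMF Bool :=
  PMF.ofFintype (fun b => ENNReal.ofReal (cond b p (1 - p))) <| by
    simp [← ENNReal.ofReal_add p.2.1 (sub_nonneg.2 p.2.2)]

/-- The deviation of the number of heads among the tosses `c i`, `i ∈ I`, from its expectation. -/
noncomputable def headsDeviation (p : ℝ) (I : Finset ℕ) (c : ℕ → Bool) : ℝ :=
  ∑ i ∈ I, ((c i).toNat - p)

theorem headsDeviation_congr {p : ℝ} {I : Finset ℕ} {c d : ℕ → Bool} (h : ∀ i ∈ I, c i = d i) :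
    headsDeviation p I c = headsDeviation p I d :=
  Finset.sum_congr rfl fun i hi => by rw [h i hi]

theorem headsDeviation_update_of_notMem {p : ℝ} {I : Finset ℕ} {n : ℕ} (hn : n ∉ I)
    (c : ℕ → Bool) (b : Bool) :
    headsDeviation p I (Function.update c n b) = headsDeviation p I c :=
  headsDeviation_congr fun _ hi => Function.update_of_ne (ne_of_mem_of_not_mem hi hn) _ _

theorem expect_coin_sq_add_le (p : unitInterval) (z : ℝ) :
    expect (coin p) (fun b => ENNReal.ofReal ((b.toNat - p + z) ^ 2)) ≤
      ENNReal.ofReal (z ^ 2 + 1) := by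
  obtain ⟨p, h0, h1⟩ := p
  have h1' : 0 ≤ 1 - p := sub_nonneg.2 h1
  rw [expect, tsum_fintype, Fintype.sum_bool]
  simp only [coin, PMF.ofFintype_apply, cond_true, cond_false]
  rw [← ENNReal.ofReal_mul h0, ← ENNReal.ofReal_mul h1',
    ← ENNReal.ofReal_add (by positivity) (by positivity)]
  refine ENNReal.ofReal_le_ofReal ?_
  simp only [Bool.toNat_true, Bool.toNat_false, Nat.cast_one, Nat.cast_zero]
  nlinarith

theorem expect_headsDeviation_sq_le (p : unitInterval) {I : Finset ℕ} {n : ℕ}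
    (hI : I ⊆ Finset.range n) :
    expect (iid (coin p) n) (fun c => ENNReal.ofReal (headsDeviation p I c ^ 2)) ≤
      ENNReal.ofReal I.card := by
  induction n generalizing I with
  | zero => simp [headsDeviation, Finset.subset_empty.1 hI, expect]
  | succ n ih =>
    rw [Finset.range_add_one] at hI
    simp_rw [iid, expect_bind, expect_map]
    by_cases hn : n ∈ I
    · have hJ : I.erase n ⊆ Finset.range n := Finset.subset_insert_iff.1 hI
      have split_last (c : ℕ → Bool) (b : Bool) : headsDeviation p I (Function.update c n b) =
          b.toNat - p + headsDeviation p (I.erase n) c := by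
        rw [headsDeviation, ← Finset.add_sum_erase _ _ hn, Function.update_self,
          ← headsDeviation_update_of_notMem (Finset.notMem_erase n I) c b, headsDeviation]
      simp only [Function.comp_def, split_last]
      refine (expect_mono _ fun c => expect_coin_sq_add_le p _).trans ?_
      simp_rw [ENNReal.ofReal_add (sq_nonneg _) zero_le_one, expect_add, expect_const]
      refine (add_le_add_left (ih hJ) _).trans ?_
      rw [← ENNReal.ofReal_add (Nat.cast_nonneg _) zero_le_one, ← Finset.card_erase_add_one hn]
      push_cast
      rfl
    · simp only [Function.comp_def, headsDeviation_update_of_notMem hn, expect_const]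
      exact ih ((Finset.subset_insert_iff_of_notMem hn).1 hI)

theorem toOuterMeasure_le_abs_headsDeviation_le (p : unitInterval) {I : Finset ℕ} {n : ℕ}
    (hI : I ⊆ Finset.range n) {a : ℝ} (ha : 0 < a) :
    (iid (coin p) n).toOuterMeasure {c | a ≤ |headsDeviation p I c|} ≤
      ENNReal.ofReal (I.card / a ^ 2) := by
  have sq_dev : {c | a ≤ |headsDeviation p I c|} =
      {c | ENNReal.ofReal (a ^ 2) ≤ ENNReal.ofReal (headsDeviation p I c ^ 2)} := by
    ext c
    rw [Set.mem_ofPred_eq, Set.mem_ofPred_eq, ENNReal.ofReal_le_ofReal_iff (sq_nonneg _), sq_le_sq,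
      abs_of_pos ha]
  rw [ENNReal.ofReal_div_of_pos (by positivity), ENNReal.le_div_iff_mul_le
    (Or.inl (by simpa using ha.ne')) (Or.inl ENNReal.ofReal_ne_top), mul_comm, sq_dev]
  exact (mul_toOuterMeasure_le_expect _ _ _).trans (expect_headsDeviation_sq_le p hI)

end Probability

section Authentication

variable {X B : Type*}

/-- What a prover is told about one step of a queue: whether the front entry has been removed, the
entry that has been appended, and an authentication tag for the latter. -/
abbrev Record (X B : Type*) := Bool × X × B

/-- What a prover has been told before step `t`. -/
def transcript (u : ℕ → Record X B) (t : ℕ) : List (Record X B) := (List.range t).map u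

/-- The step in which the entry that is at the front of the queue before step `t` was appended plus
one, when the queue has length one initially: the number of entries removed up to then. -/
def frontIndex {Z : Type*} (u : ℕ → Bool × Z) (t : ℕ) : ℕ := (List.range t).countP fun s => (u s).1

/-- The strategy of an honest prover: the entry that has come to the front of the queue, and its
tag. -/
def honestReply (d : Record X B) (l : List (Record X B)) : X × B :=
  (l.getD (l.dropLast.countP (·.1)) d).2

/-- In step `t`, the front entry is removed and the strategy `P` returns a wrong new one. -/
def Deviates (P : List (Record X B) → X × B) (u : ℕ → Record X B) (t : ℕ) : Prop :=
  (u t).1 = true ∧ P (transcript u (t + 1)) ≠ (u (frontIndex u t)).2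

/-- The key of a message authentication code in the style of Wegman and Carter: a hash function
and one-time pads that conceal the hash values. -/
structure MacKey (X B : Type*) where
  /-- the hash function -/
  hash : X → B
  /-- the one-time pads -/
  pad : ℕ → B

/-- The tag of the `t`-th message `x`. -/
def MacKey.tag [Add B] (κ : MacKey X B) (t : ℕ) (x : X) : B := κ.hash x + κ.pad t

/-- The records of the queue operations `e`, authenticated with the key `κ`. -/
def MacKey.stamp [Add B] (κ : MacKey X B) (e : ℕ → Bool × X) (t : ℕ) : Record X B :=
  ((e t).1, (e t).2, κ.tag t (e t).2)

/-- The first wrong reply of the strategy `P` is in step `t`, and its tag is valid. -/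
def Forges [Add B] (P : List (Record X B) → X × B) (u : ℕ → Record X B) (κ : MacKey X B)
    (t : ℕ) : Prop :=
  (∀ s < t, ¬ Deviates P u s) ∧ Deviates P u t ∧
    (P (transcript u (t + 1))).2 = κ.tag (frontIndex u t) (P (transcript u (t + 1))).1

theorem frontIndex_le {Z : Type*} (u : ℕ → Bool × Z) (t : ℕ) : frontIndex u t ≤ t :=
  List.countP_le_length.trans List.length_range.le

theorem frontIndex_succ {Z : Type*} (u : ℕ → Bool × Z) (t : ℕ) :
    frontIndex u (t + 1) = frontIndex u t + (u t).1.toNat := by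
  cases h : (u t).1 <;> simp [frontIndex, List.range_succ, h]

theorem transcript_succ (u : ℕ → Record X B) (t : ℕ) :
    transcript u (t + 1) = transcript u t ++ [u t] := by
  simp [transcript, List.range_succ]

theorem honestReply_transcript (d : Record X B) (u : ℕ → Record X B) (t : ℕ) :
    honestReply d (transcript u (t + 1)) = (u (frontIndex u t)).2 := by
  have front : (transcript u t).countP (·.1) = frontIndex u t := List.countP_map
  rw [honestReply, transcript_succ, List.dropLast_concat, ← transcript_succ, front,
    transcript, List.getD_eq_getElem _ _ (by simpa using Nat.lt_succ_of_le (frontIndex_le u t))]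
  simp

section Congr

variable {P : List (Record X B) → X × B} {u v : ℕ → Record X B} {t : ℕ}

theorem transcript_congr (h : ∀ s < t, u s = v s) : transcript u t = transcript v t :=
  List.map_congr_left fun s hs => h s (List.mem_range.1 hs)

theorem frontIndex_congr (h : ∀ s < t, u s = v s) : frontIndex u t = frontIndex v t :=
  List.countP_congr fun s hs => by rw [h s (List.mem_range.1 hs)]

theorem deviates_congr (h : ∀ s ≤ t, u s = v s) : Deviates P u t ↔ Deviates P v t := by
  rw [Deviates, Deviates, transcript_congr fun s hs => h s (Nat.le_of_lt_succ hs),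
    frontIndex_congr fun s hs => h s hs.le, h t le_rfl, h _ (frontIndex_le v t)]

theorem forges_congr [Add B] {κ ν : MacKey X B} (h : ∀ s ≤ t, u s = v s)
    (hash_eq : κ.hash = ν.hash) (pad_eq : ∀ s ≤ t, κ.pad s = ν.pad s) :
    Forges P u κ t ↔ Forges P v ν t := by
  refine and_congr (forall₂_congr fun s hs => not_congr <| deviates_congr fun r hr =>
    h r (hr.trans hs.le)) (and_congr (deviates_congr h) ?_)
  rw [transcript_congr fun s hs => h s (Nat.le_of_lt_succ hs),
    frontIndex_congr fun s hs => h s hs.le, MacKey.tag, MacKey.tag, hash_eq,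
    pad_eq _ (frontIndex_le v t)]

end Congr

variable [Fintype X] [DecidableEq X] [Fintype B]

theorem uniform_hash_collision_le [Nonempty B] [Add B] {x y : X} (hxy : x ≠ y) (b : B) :
    (PMF.uniformOfFintype (X → B)).toOuterMeasure {h | h x = h y + b} ≤
      (Fintype.card B : ℝ≥0∞)⁻¹ := by
  classical
  let reassign (z : {h : X → B | h x = h y + b} × B) : X → B := Function.update z.1 x z.2
  have reassign_injective : reassign.Injective := by
    rintro ⟨⟨h, hh⟩, c⟩ ⟨⟨g, hg⟩, d⟩ heq
    have off {z : X} (hz : z ≠ x) : h z = g z := by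
      simpa [reassign, Function.update_of_ne hz] using congrFun heq z
    have at_x : h x = g x := by
      rw [show h x = h y + b from hh, off hxy.symm]
      exact Eq.symm hg
    have hgh : h = g := funext fun z => (eq_or_ne z x).elim (fun hz => hz ▸ at_x) off
    have hcd : c = d := by simpa [reassign] using congrFun heq x
    subst hgh hcd
    rfl
  have hcard := Fintype.card_le_of_injective _ reassign_injective
  rw [Fintype.card_prod] at hcard
  rw [PMF.toOuterMeasure_uniformOfFintype_apply, ← one_div,
    ENNReal.le_div_iff_mul_le (by simp) (by simp), mul_comm, ← mul_div_assoc]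
  refine ENNReal.div_le_of_le_mul ?_
  rw [one_mul, mul_comm]
  exact_mod_cast hcard

variable [AddCommGroup B]

-- Given the transcript, the position and the content of the first wrong reply are determined;
-- with a valid tag, it yields a linear relation between two different hash values.
theorem uniform_forges_le (P : List (Record X B) → X × B) (u : ℕ → Record X B) :
    (PMF.uniformOfFintype (X → B)).toOuterMeasure
      {h | ∃ t, Forges P u ⟨h, fun s => (u s).2.2 - h (u s).2.1⟩ t} ≤
        (Fintype.card B : ℝ≥0∞)⁻¹ := by
  rcases Set.eq_empty_or_nonempty
    {h : X → B | ∃ t, Forges P u ⟨h, fun s => (u s).2.2 - h (u s).2.1⟩ t} with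
    empty | ⟨g, t, before, deviates, valid⟩
  · simp [empty]
  set sent := (u (frontIndex u t)).2
  set reply := P (transcript u (t + 1))
  have payload_ne : reply.1 ≠ sent.1 := fun heq => deviates.2 <| Prod.ext heq <| by
    rwa [MacKey.tag, heq, add_sub_cancel] at valid
  refine (MeasureTheory.measure_mono ?_).trans
    (uniform_hash_collision_le payload_ne (reply.2 - sent.2))
  rintro h ⟨s, before', deviates', valid'⟩
  obtain rfl : s = t := le_antisymm (not_lt.1 fun hts => before' t hts deviates)
    (not_lt.1 fun hst => before s hst deviates')
  have valid_h : reply.2 = h reply.1 + (sent.2 - h sent.1) := valid'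
  rw [Set.mem_ofPred_eq, valid_h]
  abel

/-- The distribution of a random key with `n` pads. -/
noncomputable def macKeyLaw (X B : Type*) [Fintype X] [DecidableEq X] [Fintype B] [Nonempty B]
    (n : ℕ) : PMF (MacKey X B) :=
  (PMF.uniformOfFintype (X → B)).bind fun h =>
    (iid (PMF.uniformOfFintype B) n).map (MacKey.mk h)

-- Drawing the tags instead of the pads makes the transcript independent of the hash function.
theorem macKeyLaw_eq_bind_tags (x : ℕ → X) (n : ℕ) :
    macKeyLaw X B n = (iid (PMF.uniformOfFintype B) n).bind fun τ =>
      (PMF.uniformOfFintype (X → B)).map fun h =>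
        ⟨h, fun t => if t < n then τ t - h (x t) else τ t⟩ := by
  have translate (h : X → B) (t : ℕ) :
      (PMF.uniformOfFintype B).map (· - h (x t)) = PMF.uniformOfFintype B :=
    uniformOfFintype_map_equiv (Equiv.subRight (h (x t)))
  rw [macKeyLaw]
  simp_rw [← PMF.bind_pure_comp]
  rw [PMF.bind_comm (iid _ n)]
  refine congrArg _ (funext fun h => ?_)
  conv_lhs => rw [← iid_map_of_map_eq (translate h) n]
  rw [PMF.bind_map]
  rfl

theorem macKeyLaw_forges_le (P : List (Record X B) → X × B) (e : ℕ → Bool × X) (n : ℕ) :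
    (macKeyLaw X B n).toOuterMeasure {κ | ∃ t < n, Forges P (κ.stamp e) κ t} ≤
      (Fintype.card B : ℝ≥0∞)⁻¹ := by
  rw [macKeyLaw_eq_bind_tags fun t => (e t).2]
  refine toOuterMeasure_bind_le _ _ fun τ => ?_
  rw [PMF.toOuterMeasure_map_apply]
  refine (MeasureTheory.measure_mono ?_).trans
    (uniform_forges_le P fun t => ((e t).1, (e t).2, τ t))
  rintro h ⟨t, htn, ht⟩
  have before {s : ℕ} (hs : s ≤ t) : s < n := hs.trans_lt htn
  refine ⟨t, (forges_congr (fun s hs => ?_) ?_ fun s hs => ?_).1 ht⟩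
  · simp [MacKey.stamp, MacKey.tag, before hs]
  · rfl
  · simp [before hs]

end Authentication

section Randomness

/-- The distribution of two independent samples of `μ`, indexed by the two provers. -/
noncomputable def pairLaw {S : Type*} (μ : PMF S) : PMF (Bool → S) :=
  μ.bind fun a => μ.map fun b i => cond i b a

theorem pairLaw_bind_map {S T U : Type*} (μ : PMF S) (ρ : PMF T) (f : S → T → U) :
    pairLaw (μ.bind fun a => ρ.map (f a)) =
      (pairLaw μ).bind fun a => (pairLaw ρ).map fun x i => f (a i) (x i) := by
  simp only [pairLaw, ← PMF.bind_pure_comp, PMF.bind_bind, PMF.pure_bind, Function.comp_def]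
  refine congrArg _ (funext fun a => ?_)
  rw [PMF.bind_comm]
  refine congrArg _ (funext fun b => congrArg _ (funext fun x => congrArg _ (funext fun y => ?_)))
  exact congrArg _ (funext fun i => by cases i <;> rfl)

theorem pairLaw_eq_bind_map (i : Bool) {S : Type*} (μ : PMF S) :
    pairLaw μ = μ.bind fun b => μ.map fun a j => if j = i then a else b := by
  simp only [pairLaw, ← PMF.bind_pure_comp, Function.comp_def]
  cases i
  · rw [PMF.bind_comm]
    refine congrArg _ (funext fun b => congrArg _ (funext fun a => congrArg _ (funext fun j => ?_)))
    cases j <;> rfl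
  · refine congrArg _ (funext fun b => congrArg _ (funext fun a => congrArg _ (funext fun j => ?_)))
    cases j <;> rfl

variable {Γ B : Type*}

/-- The random choices of the verifier: the coin tosses of the simulated machine, and the
authentication keys for the two provers. The messages for one prover contain a symbol of the queue
and a pad for the other prover. -/
structure Randomness (Γ B : Type*) where
  /-- the coin tosses -/
  toss : ℕ → Bool
  /-- the authentication keys -/
  key : Bool → MacKey (Γ × B) B

/-- The records for prover `i` of the queue operations `e`: along with the symbol that is appended
in step `t`, this prover stores the pad for the `(t + 1)`-th record of the other prover. -/
def Randomness.record [Add B] (ω : Randomness Γ B) (e : ℕ → Bool × Γ) (i : Bool) :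
    ℕ → Record (Γ × B) B :=
  (ω.key i).stamp fun t => ((e t).1, (e t).2, (ω.key (!i)).pad (t + 1))

/-- Replace the `n`-th toss and the `n + 1`-th pads. -/
def Randomness.extend (ω : Randomness Γ B) (n : ℕ) (x : Bool × (Bool → B)) : Randomness Γ B where
  toss := Function.update ω.toss n x.1
  key i := ⟨(ω.key i).hash, Function.update (ω.key i).pad (n + 1) (x.2 i)⟩

variable [Fintype Γ] [DecidableEq Γ] [Fintype B] [DecidableEq B]

/-- The distribution of the random choices up to step `n`: independent tosses of a coin with
bias `p`, and two independent random keys. -/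
noncomputable def randomnessLaw (Γ B : Type*) [Fintype Γ] [DecidableEq Γ] [Fintype B]
    [DecidableEq B] [Nonempty B] (p : unitInterval) (n : ℕ) : PMF (Randomness Γ B) :=
  (iid (coin p) n).bind fun c => (pairLaw (macKeyLaw (Γ × B) B (n + 1))).map (Randomness.mk c)

/-- The distribution of the random choices in one step: a coin toss and two pads. -/
noncomputable def sampleLaw (B : Type*) [Fintype B] [Nonempty B] (p : unitInterval) :
    PMF (Bool × (Bool → B)) :=
  (coin p).bind fun c => (pairLaw (PMF.uniformOfFintype B)).map (Prod.mk c)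

theorem randomnessLaw_succ [Nonempty B] (p : unitInterval) (n : ℕ) :
    randomnessLaw Γ B p (n + 1) =
      (randomnessLaw Γ B p n).bind fun ω => (sampleLaw B p).map (ω.extend n) := by
  have key_succ : macKeyLaw (Γ × B) B (n + 2) =
      (macKeyLaw (Γ × B) B (n + 1)).bind fun κ => (PMF.uniformOfFintype B).map fun x =>
        ⟨κ.hash, Function.update κ.pad (n + 1) x⟩ := by
    rw [macKeyLaw, macKeyLaw]
    simp only [iid, ← PMF.bind_pure_comp, PMF.bind_bind, PMF.pure_bind, Function.comp_def]
  rw [randomnessLaw, key_succ, pairLaw_bind_map, iid, randomnessLaw, sampleLaw]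
  simp only [← PMF.bind_pure_comp, PMF.bind_bind, PMF.pure_bind, Function.comp_def]
  refine congrArg _ (funext fun c => ?_)
  rw [PMF.bind_comm]
  rfl

theorem randomnessLaw_map_toss [Nonempty B] (p : unitInterval) (n : ℕ) :
    (randomnessLaw Γ B p n).map Randomness.toss = iid (coin p) n := by
  have toss_mk (c : ℕ → Bool) :
      Randomness.toss ∘ Randomness.mk (Γ := Γ) (B := B) c = Function.const _ c := rfl
  simp only [randomnessLaw, PMF.map_bind, PMF.map_comp, toss_mk, PMF.map_const, PMF.bind_pure]

theorem randomnessLaw_forges_le [AddCommGroup B] (P : List (Record (Γ × B) B) → (Γ × B) × B)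
    (e : (ℕ → Bool) → ℕ → Bool × Γ) (i : Bool) (p : unitInterval) (n : ℕ) :
    (randomnessLaw Γ B p n).toOuterMeasure
      {ω | ∃ t ≤ n, Forges P (ω.record (e ω.toss) i) (ω.key i) t} ≤
        (Fintype.card B : ℝ≥0∞)⁻¹ := by
  refine toOuterMeasure_bind_le _ _ fun c => ?_
  rw [pairLaw_eq_bind_map i, PMF.map_bind]
  refine toOuterMeasure_bind_le _ _ fun κ => ?_
  rw [PMF.map_comp, PMF.toOuterMeasure_map_apply]
  refine (MeasureTheory.measure_mono ?_).trans
    (macKeyLaw_forges_le P (fun t => ((e c t).1, (e c t).2, κ.pad (t + 1))) (n + 1))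
  rintro ν ⟨t, htn, ht⟩
  refine ⟨t, Nat.lt_succ_of_le htn, ?_⟩
  simpa [Randomness.record] using ht

end Randomness

/-- A move that does not leave the tape through the right end-marker. -/
def Move.guard {α : Type*} : TapeSymbol α → Move → Move
  | TapeSymbol.rightEnd, _ => Move.stay
  | _, m => m

theorem Move.guard_rightEnd {α : Type*} (m : Move) :
    m.guard (TapeSymbol.rightEnd : TapeSymbol α) = Move.stay := by
  cases m <;> rfl

/-- What a queue machine does in one step: it halts with a verdict, or it enters the state `q`,
appends the symbol `push` to its queue, removes the front symbol if `pop` holds, and moves its input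
head. -/
inductive Action (Q Γ : Type*) where
  | halt (verdict : Bool)
  | proceed (q : Q) (push : Γ) (pop : Bool) (move : Move)

/-- A finite control with a queue, a coin and a one-way input head. The action depends on the state,
the front symbol of the queue, the scanned symbol and a coin toss. Initially, the queue consists of
the symbol `blank`, and the head is on the cell next to the left end-marker. -/
structure QueueMachine (α : Type*) (Q Γ : Type) where
  /-- the initial state -/
  start : Q
  /-- the initial contents of the queue -/
  blank : Γ
  /-- the program -/
  δ : Q → Γ → TapeSymbol α → Bool → Action Q Γ

namespace QueueMachine

variable {α : Type*} {Q Γ : Type}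

/-- The configurations of a queue machine. -/
inductive Config (Q Γ : Type*) where
  | halted (verdict : Bool)
  | running (q : Q) (queue : List Γ) (pos : ℕ)

/-- The configuration after one more step with the coin toss `c`. -/
def next (M : QueueMachine α Q Γ) (w : List α) : Config Q Γ → Bool → Config Q Γ
  | .halted b, _ => .halted b
  | .running q l i, c =>
    match M.δ q (l.headD M.blank) (tapeAt w i) c with
    | .halt b => .halted b
    | .proceed q' y pop v =>
      .running q' ((if pop then l.tail else l) ++ [y]) ((v.guard (tapeAt w i)).apply i)

/-- The configuration after `t` steps with the coin tosses `c`. -/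
def config (M : QueueMachine α Q Γ) (w : List α) (c : ℕ → Bool) : ℕ → Config Q Γ
  | 0 => .running M.start [M.blank] 1
  | t + 1 => M.next w (M.config w c t) (c t)

/-- The operation on the queue in step `t`: whether the front symbol is removed, and the symbol that
is appended. The value is arbitrary if there is none because the machine halts. -/
def operation (M : QueueMachine α Q Γ) (w : List α) (c : ℕ → Bool) (t : ℕ) : Bool × Γ :=
  match M.config w c t with
  | .halted _ => (false, M.blank)
  | .running q l i =>
    match M.δ q (l.headD M.blank) (tapeAt w i) (c t) with
    | .halt _ => (false, M.blank)
    | .proceed _ y pop _ => (pop, y)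

section Computation

variable {M : QueueMachine α Q Γ} {w : List α} {c : ℕ → Bool} {t i : ℕ} {q q' : Q} {l : List Γ}
  {y : Γ} {b pop : Bool} {v : Move}

theorem config_succ_of_halted (h : M.config w c t = .halted b) :
    M.config w c (t + 1) = .halted b := by
  rw [config, h, next]

theorem config_succ_of_halt (h : M.config w c t = .running q l i)
    (hδ : M.δ q (l.headD M.blank) (tapeAt w i) (c t) = .halt b) :
    M.config w c (t + 1) = .halted b := by
  simp only [config, h, next, hδ]

theorem config_succ_of_proceed (h : M.config w c t = .running q l i)
    (hδ : M.δ q (l.headD M.blank) (tapeAt w i) (c t) = .proceed q' y pop v) :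
    M.config w c (t + 1) =
      .running q' ((if pop then l.tail else l) ++ [y]) ((v.guard (tapeAt w i)).apply i) := by
  simp only [config, h, next, hδ]

theorem operation_of_proceed (h : M.config w c t = .running q l i)
    (hδ : M.δ q (l.headD M.blank) (tapeAt w i) (c t) = .proceed q' y pop v) :
    M.operation w c t = (pop, y) := by
  simp only [operation, h, hδ]

theorem queue_eq_drop (h : M.config w c t = .running q l i) :
    l = (M.blank :: (List.range t).map fun s => (M.operation w c s).2).drop
      (frontIndex (M.operation w c) t) := by
  induction t generalizing q l i with
  | zero =>
    rw [config, Config.running.injEq] at h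
    exact h.2.1.symm
  | succ t ih =>
    rcases hc : M.config w c t with b | ⟨q₀, l₀, i₀⟩
    · cases (config_succ_of_halted hc).symm.trans h
    rcases hδ : M.δ q₀ (l₀.headD M.blank) (tapeAt w i₀) (c t) with b | ⟨q₁, y, pop, v⟩
    · cases (config_succ_of_halt hc hδ).symm.trans h
    have front_le : frontIndex (M.operation w c) t + pop.toNat ≤
        (M.blank :: (List.range t).map fun s => (M.operation w c s).2).length := by
      have := frontIndex_le (M.operation w c) t
      cases pop <;> simp <;> omega
    rw [config_succ_of_proceed hc hδ, Config.running.injEq] at h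
    rw [← h.2.1, frontIndex_succ, operation_of_proceed hc hδ, List.range_succ, List.map_append,
      ← List.cons_append, List.drop_append_of_le_length front_le, ← List.drop_drop, ← ih hc,
      List.map_singleton, operation_of_proceed hc hδ]
    cases pop <;> simp

theorem queue_ne_nil (h : M.config w c t = .running q l i) : l ≠ [] := by
  rw [queue_eq_drop h, Ne, List.drop_eq_nil_iff, not_le]
  simpa using Nat.lt_succ_of_le (frontIndex_le (M.operation w c) t)

theorem head_succ_of_not_pop {q' : Q} {l' : List Γ} {i' : ℕ} (h : M.config w c t = .running q l i)
    (h' : M.config w c (t + 1) = .running q' l' i') (hpop : (M.operation w c t).1 = false) :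
    l'.headD M.blank = l.headD M.blank := by
  have extend : l' = l ++ [(M.operation w c t).2] := by
    rw [queue_eq_drop h', frontIndex_succ, hpop, List.range_succ, List.map_append,
      ← List.cons_append, List.drop_append_of_le_length, queue_eq_drop h]
    · rfl
    · simpa using (frontIndex_le (M.operation w c) t).trans (Nat.le_succ t)
  obtain ⟨x, l, rfl⟩ := List.exists_cons_of_ne_nil (queue_ne_nil h)
  rw [extend]
  rfl

theorem head_succ_of_pop (h : M.config w c (t + 1) = .running q l i)
    (hpop : (M.operation w c t).1 = true) :
    l.headD M.blank = (M.operation w c (frontIndex (M.operation w c) t)).2 := by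
  have front_lt := Nat.lt_succ_of_le (frontIndex_le (M.operation w c) t)
  rw [queue_eq_drop h, frontIndex_succ, hpop, Bool.toNat_true, List.drop_succ_cons,
    List.headD_eq_head?_getD, List.head?_drop]
  simp [front_lt]

end Computation

end QueueMachine

/-- The halting state with the given verdict. -/
def State.verdict {R C : Type} (b : Bool) : State R C :=
  cond b State.accepting State.rejecting

namespace Verifier

variable {α : Type*} (V : Verifier α) (P₁ P₂ : Prover α V.Υ) (w : List α)

/-- The step from a communicating or halting state, which does not involve randomness. -/
def exchange (c : V.Config) : V.Config :=
  match c.state with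
  | State.communicating k =>
    { state := V.δc k (P₁ w (c.sent₁ ++ [V.send₁ k])) (P₂ w (c.sent₂ ++ [V.send₂ k]))
      pos := c.pos
      sent₁ := c.sent₁ ++ [V.send₁ k]
      sent₂ := c.sent₂ ++ [V.send₂ k] }
  | _ => c

variable {V} {c : V.Config}

theorem step_of_reading {r : V.R} (h : c.state = State.reading r) :
    V.step P₁ P₂ w c = (V.δr r (tapeAt w c.pos)).map fun sd =>
      { c with state := sd.1, pos := sd.2.apply c.pos } := by
  rw [step, h]

theorem step_eq_pure_exchange (h : ∀ r, c.state ≠ State.reading r) :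
    V.step P₁ P₂ w c = PMF.pure (V.exchange P₁ P₂ w c) := by
  unfold step exchange
  rcases hs : c.state with r | k | _ | _
  · exact absurd hs (h r)
  all_goals rfl

theorem exchange_of_verdict {b : Bool} (h : c.state = State.verdict b) :
    V.exchange P₁ P₂ w c = c := by
  cases b <;> simp [exchange, h, State.verdict]

theorem step_of_verdict {b : Bool} (h : c.state = State.verdict b) :
    V.step P₁ P₂ w c = PMF.pure c := by
  cases b <;> simp [step, h, State.verdict]

end Verifier

/-- The memory of a verifier that simulates a queue machine: the state and the front symbol of the
machine, and for each prover the hash function and the pads for the records of the front and of the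
next symbol. -/
structure Memory (Q Γ B : Type) where
  /-- the state of the machine -/
  ctl : Q
  /-- the front symbol of the queue -/
  front : Γ
  /-- the hash functions -/
  hash : Bool → Γ × B → B
  /-- the pads for the record of the front symbol -/
  frontPad : Bool → B
  /-- the pads for the next record -/
  backPad : Bool → B

instance {Q Γ B : Type} [Finite Q] [Finite Γ] [Finite B] : Finite (Memory Q Γ B) :=
  Finite.of_injective (fun m => (m.ctl, m.front, m.hash, m.frontPad, m.backPad)) <| by
    rintro ⟨⟩ ⟨⟩ h
    simpa using h

/-- A communicating state of this verifier: its memory, an operation on the queue, and the pads for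
the record after the next one. -/
abbrev Query (Q Γ B : Type) := Memory Q Γ B × (Bool × Γ) × (Bool → B)

/-- The states of this verifier. The initial state is `none`. -/
abbrev SimState (Q Γ B : Type) := State (Option (Memory Q Γ B)) (Query Q Γ B)

/-- The record sent to prover `i`. -/
def Query.message {Q Γ B : Type} [Add B] (k : Query Q Γ B) (i : Bool) : Record (Γ × B) B :=
  (k.2.1.1, (k.2.1.2, k.2.2 (!i)), k.1.hash i (k.2.1.2, k.2.2 (!i)) + k.1.backPad i)

/-- The reply `r` of prover `i` has a valid tag. -/
def Memory.Accepts {Q Γ B : Type} [Add B] (m : Memory Q Γ B) (i : Bool) (r : (Γ × B) × B) : Prop :=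
  r.2 = m.hash i r.1 + m.frontPad i

open Classical in
/-- The reaction to the replies `r`, whose first component is a claim about the membership of the
input. When the tag of a prover is not valid, the verifier follows the claim of the other prover if
`trust` holds, and rejects otherwise. -/
noncomputable def Query.receive {Q Γ B : Type} [Add B] (trust : Bool) (k : Query Q Γ B)
    (r : Bool → Record (Γ × B) B) : SimState Q Γ B :=
  if k.2.1.1 = false then State.reading (some { k.1 with backPad := k.2.2 })
  else if ¬ k.1.Accepts false (r false).2 then State.verdict (trust && (r true).1)
  else if ¬ k.1.Accepts true (r true).2 then State.verdict (trust && (r false).1)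
  else State.reading (some { k.1 with
    front := (r false).2.1.1
    frontPad := fun i => (r (!i)).2.1.2
    backPad := k.2.2 })

section Receive

variable {Q Γ B : Type} [Add B] (trust : Bool) {k : Query Q Γ B} {r : Bool → Record (Γ × B) B}

theorem Query.receive_of_not_pop (hpop : k.2.1.1 = false) :
    k.receive trust r = State.reading (some { k.1 with backPad := k.2.2 }) :=
  if_pos hpop

theorem Query.receive_of_accepts (hpop : k.2.1.1 = true)
    (valid : ∀ i, k.1.Accepts i (r i).2) :
    k.receive trust r = State.reading (some { k.1 with
      front := (r false).2.1.1
      frontPad := fun i => (r (!i)).2.1.2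
      backPad := k.2.2 }) := by
  simp [receive, hpop, valid]

theorem Query.receive_of_not_accepts (hpop : k.2.1.1 = true)
    (invalid : ∃ i, ¬ k.1.Accepts i (r i).2) :
    ∃ i, ¬ k.1.Accepts i (r i).2 ∧ k.receive trust r = State.verdict (trust && (r (!i)).1) := by
  by_cases h : k.1.Accepts false (r false).2
  · have h' : ¬ k.1.Accepts true (r true).2 := by simpa [h] using invalid
    exact ⟨true, h', by simp [receive, hpop, h, h']⟩
  · exact ⟨false, h, by simp [receive, hpop, h]⟩

end Receive

namespace QueueMachine

variable {α : Type*} {Q Γ B : Type}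

/-- The effect of a reading step, where `x` consists of a coin toss and the next pads. -/
def read (M : QueueMachine α Q Γ) (m : Memory Q Γ B) (a : TapeSymbol α) (x : Bool × (Bool → B)) :
    SimState Q Γ B × Move :=
  match M.δ m.ctl m.front a x.1 with
  | .halt b => (State.verdict b, Move.stay)
  | .proceed q y pop v => (State.communicating ({ m with ctl := q }, (pop, y), x.2), v.guard a)

theorem read_fst_ne_reading (M : QueueMachine α Q Γ) (m : Memory Q Γ B) (a : TapeSymbol α)
    (x : Bool × (Bool → B)) (r : Option (Memory Q Γ B)) : (M.read m a x).1 ≠ State.reading r := by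
  rw [read]
  rcases M.δ m.ctl m.front a x.1 with (_ | _) | _ <;> simp [State.verdict]

/-- The memory after the initial step. -/
def initialMemory (M : QueueMachine α Q Γ) (ω : Randomness Γ B) : Memory Q Γ B where
  ctl := M.start
  front := M.blank
  hash i := (ω.key i).hash
  frontPad i := (ω.key i).pad 0
  backPad i := (ω.key i).pad 0

/-- The states between two cycles. -/
def IsSettled (s : SimState Q Γ B) : Prop :=
  (∃ m, s = State.reading (some m)) ∨ ∃ b, s = State.verdict b

theorem isSettled_receive [Add B] (trust : Bool) (k : Query Q Γ B) (r : Bool → Record (Γ × B) B) :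
    IsSettled (k.receive trust r) := by
  rw [Query.receive]
  split_ifs
  exacts [.inl ⟨_, rfl⟩, .inl ⟨_, rfl⟩, .inr ⟨_, rfl⟩, .inr ⟨_, rfl⟩]

section Faithful

variable [Add B] (M : QueueMachine α Q Γ) (trust : Bool) (w : List α) (ω : Randomness Γ B)

/-- The records for prover `i` when the verifier simulates `M` on the input `w`. -/
abbrev record (i : Bool) : ℕ → Record (Γ × B) B :=
  ω.record (M.operation w ω.toss) i

/-- The memory of the verifier after `t` cycles when the machine is in the state `q` with the front
symbol `x`, if the provers have stored the queue faithfully. -/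
def faithfulMemory (t : ℕ) (q : Q) (x : Γ) : Memory Q Γ B where
  ctl := q
  front := x
  hash i := (ω.key i).hash
  frontPad i := (ω.key i).pad (frontIndex (M.operation w ω.toss) t)
  backPad i := (ω.key i).pad t

/-- The communicating state that follows this memory when the machine enters the state `q'`. -/
def faithfulQuery (t : ℕ) (q' : Q) (x : Γ) : Query Q Γ B :=
  (M.faithfulMemory w ω t q' x, M.operation w ω.toss t, fun i => (ω.key i).pad (t + 1))

variable {M w ω} {t i i' : ℕ} {q q' : Q} {l l' : List Γ}

theorem faithfulQuery_receive_of_not_pop (r : Bool → Record (Γ × B) B)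
    (h : M.config w ω.toss t = .running q l i)
    (h' : M.config w ω.toss (t + 1) = .running q' l' i')
    (hpop : (M.operation w ω.toss t).1 = false) :
    (M.faithfulQuery w ω t q' (l.headD M.blank)).receive trust r =
      State.reading (some (M.faithfulMemory w ω (t + 1) q' (l'.headD M.blank))) := by
  rw [head_succ_of_not_pop h h' hpop, Query.receive_of_not_pop trust hpop, faithfulMemory,
    frontIndex_succ, hpop]
  rfl

theorem faithfulQuery_receive_of_pop {r : Bool → Record (Γ × B) B}
    (h' : M.config w ω.toss (t + 1) = .running q' l' i')
    (hpop : (M.operation w ω.toss t).1 = true)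
    (hr : ∀ i, (r i).2 = (M.record w ω i (frontIndex (M.operation w ω.toss) t)).2) :
    (M.faithfulQuery w ω t q' (l.headD M.blank)).receive trust r =
      State.reading (some (M.faithfulMemory w ω (t + 1) q' (l'.headD M.blank))) := by
  have valid (i : Bool) :
      (M.faithfulMemory w ω t q' (l.headD M.blank)).Accepts i (r i).2 := by
    rw [hr]
    rfl
  rw [head_succ_of_pop h' hpop, Query.receive_of_accepts trust hpop valid, faithfulMemory,
    frontIndex_succ, hpop]
  simp only [hr]
  simp [Randomness.record, MacKey.stamp, faithfulQuery, faithfulMemory]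

end Faithful

variable [Fintype Γ] [DecidableEq Γ] [Fintype B] [DecidableEq B]

/-- The transition probabilities of the verifier. In the initial step, it draws the hash functions
and the first pads. -/
noncomputable def transition [Nonempty B] (M : QueueMachine α Q Γ) (p : unitInterval) :
    Option (Memory Q Γ B) → TapeSymbol α → PMF (SimState Q Γ B × Move)
  | none, a => (randomnessLaw Γ B p 0).map fun ω =>
      (State.reading (some (M.initialMemory ω)), Move.right.guard a)
  | some m, a => (sampleLaw B p).map (M.read m a)

theorem transition_rightEnd [Nonempty B] (M : QueueMachine α Q Γ) (p : unitInterval)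
    (r : Option (Memory Q Γ B)) (s : SimState Q Γ B) :
    M.transition p r TapeSymbol.rightEnd (s, Move.right) = 0 := by
  rw [PMF.apply_eq_zero_iff]
  cases r with
  | none =>
    rw [transition, PMF.support_map]
    rintro ⟨x, -, hx⟩
    simp [Move.guard_rightEnd] at hx
  | some m =>
    rw [transition, PMF.support_map]
    rintro ⟨x, -, hx⟩
    rw [read] at hx
    split at hx <;> simp [Move.guard_rightEnd] at hx

variable (B) in
/-- The verifier that simulates the queue machine `M`, using coins with bias `p`, while the provers
store the queue. -/
noncomputable abbrev verifier [Finite Q] [Nonempty B] [Add B] (M : QueueMachine α Q Γ)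
    (p : unitInterval) (trust : Bool) : Verifier α where
  R := Option (Memory Q Γ B)
  C := Query Q Γ B
  Υ := Record (Γ × B) B
  start := none
  δr := M.transition p
  δr_rightEnd := M.transition_rightEnd p
  send₁ k := k.message false
  send₂ k := k.message true
  δc k r₁ r₂ := k.receive trust fun i => cond i r₂ r₁

section Simulation

variable [Finite Q] [AddCommGroup B] (M : QueueMachine α Q Γ) (p : unitInterval) (trust : Bool)
  (P : Bool → Prover α (Record (Γ × B) B)) (w : List α)

/-- The effect of a reading step followed by a communicating step. -/
noncomputable def cycle (c : (M.verifier B p trust).Config) (x : Bool × (Bool → B)) :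
    (M.verifier B p trust).Config :=
  match c.state with
  | State.reading (some m) =>
    (M.verifier B p trust).exchange (P false) (P true) w
      { c with
        state := (M.read m (tapeAt w c.pos) x).1
        pos := (M.read m (tapeAt w c.pos) x).2.apply c.pos }
  | _ => c

/-- The configuration of the verifier after the initial step and `t` cycles. -/
noncomputable def trace (ω : Randomness Γ B) : ℕ → (M.verifier B p trust).Config
  | 0 => ⟨State.reading (some (M.initialMemory ω)), 1, [], []⟩
  | t + 1 => M.cycle p trust P w (trace ω t) (ω.toss t, fun i => (ω.key i).pad (t + 1))

variable {M p trust w} {c : (M.verifier B p trust).Config} {b : Bool}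

theorem cycle_of_verdict (h : c.state = State.verdict b) (x : Bool × (Bool → B)) :
    M.cycle p trust P w c x = c := by
  cases b <;> simp [cycle, h, State.verdict]

theorem cycle_of_halt {m : Memory Q Γ B} {x : Bool × (Bool → B)}
    (hc : c.state = State.reading (some m))
    (hδ : M.δ m.ctl m.front (tapeAt w c.pos) x.1 = .halt b) :
    (M.cycle p trust P w c x).state = State.verdict b := by
  simp only [cycle, hc, read, hδ]
  rw [Verifier.exchange_of_verdict (b := b) _ _ _ rfl]

theorem cycle_of_proceed {m : Memory Q Γ B} {x : Bool × (Bool → B)} {q : Q} {y : Γ} {pop : Bool}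
    {v : Move} (hc : c.state = State.reading (some m))
    (hδ : M.δ m.ctl m.front (tapeAt w c.pos) x.1 = .proceed q y pop v) (k : Query Q Γ B)
    (hk : k = ({ m with ctl := q }, (pop, y), x.2)) :
    M.cycle p trust P w c x =
      { state := k.receive trust fun i =>
          P i w (cond i c.sent₂ c.sent₁ ++ [k.message i])
        pos := (v.guard (tapeAt w c.pos)).apply c.pos
        sent₁ := c.sent₁ ++ [k.message false]
        sent₂ := c.sent₂ ++ [k.message true] } := by
  subst hk
  simp only [cycle, hc, read, hδ, Verifier.exchange]
  congr 2
  funext i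
  cases i <;> rfl

theorem isSettled_cycle (h : IsSettled c.state) (x : Bool × (Bool → B)) :
    IsSettled (M.cycle p trust P w c x).state := by
  rcases h with ⟨m, hm⟩ | ⟨b, hb⟩
  · rcases hδ : M.δ m.ctl m.front (tapeAt w c.pos) x.1 with b | ⟨q, y, pop, v⟩
    · exact .inr ⟨b, cycle_of_halt P hm hδ⟩
    · rw [cycle_of_proceed P hm hδ _ rfl]
      dsimp only
      apply isSettled_receive
  · rw [cycle_of_verdict P hb]
    exact .inr ⟨b, hb⟩

theorem step_bind_step (h : IsSettled c.state) :
    ((M.verifier B p trust).step (P false) (P true) w c).bind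
        ((M.verifier B p trust).step (P false) (P true) w) =
      (sampleLaw B p).map (M.cycle p trust P w c) := by
  rcases h with ⟨m, hm⟩ | ⟨b, hb⟩
  · rw [Verifier.step_of_reading _ _ _ hm]
    change (((sampleLaw B p).map _).map _).bind _ = _
    rw [PMF.map_comp, PMF.bind_map, ← PMF.bind_pure_comp]
    refine congrArg _ (funext fun x => ?_)
    refine (Verifier.step_eq_pure_exchange _ _ _ (M.read_fst_ne_reading m _ x)).trans ?_
    simp only [Function.comp_apply, cycle, hm]
  · have : M.cycle p trust P w c = Function.const _ c := funext (cycle_of_verdict P hb)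
    rw [Verifier.step_of_verdict _ _ _ hb, PMF.pure_bind, Verifier.step_of_verdict _ _ _ hb, this,
      PMF.map_const]

variable (M p trust w)

theorem isSettled_trace (ω : Randomness Γ B) (t : ℕ) :
    IsSettled (M.trace p trust P w ω t).state := by
  induction t with
  | zero => exact .inl ⟨_, rfl⟩
  | succ t ih => exact isSettled_cycle P ih _

theorem trace_extend (ω : Randomness Γ B) (x : Bool × (Bool → B)) {n t : ℕ} (ht : t ≤ n) :
    M.trace p trust P w (ω.extend n x) t = M.trace p trust P w ω t := by
  induction t with
  | zero => simp [trace, initialMemory, Randomness.extend]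
  | succ t ih =>
    have hn : t ≠ n := (Nat.lt_of_succ_le ht).ne
    rw [trace, ih (Nat.le_of_succ_le ht), trace]
    simp [Randomness.extend, hn]

theorem run_eq_map_trace (n : ℕ) :
    (M.verifier B p trust).run (P false) (P true) w (2 * n + 1) =
      (randomnessLaw Γ B p n).map fun ω => M.trace p trust P w ω n := by
  induction n with
  | zero =>
    rw [Nat.mul_zero, Verifier.run, Verifier.run, PMF.pure_bind,
      Verifier.step_of_reading _ _ _ rfl]
    exact PMF.map_comp _ _ _
  | succ n ih =>
    rw [Nat.mul_succ, Verifier.run, Verifier.run, ih, PMF.bind_bind, PMF.bind_map,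
      randomnessLaw_succ, PMF.map_bind]
    refine congrArg _ (funext fun ω => ?_)
    rw [Function.comp_apply, step_bind_step P (isSettled_trace M p trust P w ω n), PMF.map_comp]
    refine congrArg (PMF.map · _) (funext fun x => ?_)
    rw [Function.comp_apply, trace, trace_extend M p trust P w ω x le_rfl]
    simp [Randomness.extend]

section Synchronization

variable (ω : Randomness Γ B)

/-- The first `t` cycles of the verifier simulate `t` steps of the machine, without any wrong
replies. -/
def Synced (t : ℕ) : Prop :=
  (∃ q l i, M.config w ω.toss t = .running q l i ∧ M.trace p trust P w ω t =
    { state := State.reading (some (M.faithfulMemory w ω t q (l.headD M.blank)))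
      pos := i
      sent₁ := transcript (M.record w ω false) t
      sent₂ := transcript (M.record w ω true) t }) ∧
  ∀ i, ∀ s < t, ¬ Deviates (fun l => (P i w l).2) (M.record w ω i) s

variable {M p trust P w ω} {t i : ℕ} {q q' : Q} {l : List Γ} {y : Γ} {pop : Bool} {v : Move}

theorem trace_succ_of_proceed (hc : M.config w ω.toss t = .running q l i)
    (hδ : M.δ q (l.headD M.blank) (tapeAt w i) (ω.toss t) = .proceed q' y pop v)
    (ht : M.trace p trust P w ω t =
      { state := State.reading (some (M.faithfulMemory w ω t q (l.headD M.blank)))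
        pos := i
        sent₁ := transcript (M.record w ω false) t
        sent₂ := transcript (M.record w ω true) t }) :
    M.trace p trust P w ω (t + 1) =
      { state := (M.faithfulQuery w ω t q' (l.headD M.blank)).receive trust fun i =>
          P i w (transcript (M.record w ω i) (t + 1))
        pos := (v.guard (tapeAt w i)).apply i
        sent₁ := transcript (M.record w ω false) (t + 1)
        sent₂ := transcript (M.record w ω true) (t + 1) } := by
  have query_eq : M.faithfulQuery w ω t q' (l.headD M.blank) =
      ({ M.faithfulMemory w ω t q (l.headD M.blank) with ctl := q' }, (pop, y),
        fun i => (ω.key i).pad (t + 1)) := by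
    rw [faithfulQuery, operation_of_proceed hc hδ]
    rfl
  have sent (i : Bool) : transcript (M.record w ω i) t ++
      [(M.faithfulQuery w ω t q' (l.headD M.blank)).message i] =
        transcript (M.record w ω i) (t + 1) := (transcript_succ _ _).symm
  rw [trace, ht, cycle_of_proceed P rfl hδ _ query_eq, ← sent false, ← sent true]
  congr 2
  funext i
  rw [← sent i]
  cases i <;> rfl

variable {b : Bool} {d : Record (Γ × B) B}

theorem Synced.succ (h : M.Synced p trust P w ω t)
    (no_forgery : ∀ i, ¬ Forges (fun l => (P i w l).2) (M.record w ω i) (ω.key i) t)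
    (hb : ∀ i, (∀ l, (P i w l).2 = honestReply d l) ∨ ∀ l, (trust && (P (!i) w l).1) = b) :
    M.Synced p trust P w ω (t + 1) ∨
      (∃ b', M.config w ω.toss (t + 1) = .halted b' ∧
        (M.trace p trust P w ω (t + 1)).state = State.verdict b') ∨
      (M.trace p trust P w ω (t + 1)).state = State.verdict b := by
  obtain ⟨⟨q, l, i, hc, ht⟩, faithful⟩ := h
  rcases hδ : M.δ q (l.headD M.blank) (tapeAt w i) (ω.toss t) with b' | ⟨q', y, pop, v⟩
  · refine .inr (.inl ⟨b', config_succ_of_halt hc hδ, ?_⟩)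
    rw [trace, ht]
    exact cycle_of_halt P rfl hδ
  have hc' := config_succ_of_proceed hc hδ
  rw [Synced, trace_succ_of_proceed hc hδ ht]
  have faithful_succ
      (h : ∀ i, ¬ Deviates (fun l => (P i w l).2) (M.record w ω i) t) (i : Bool) :
      ∀ s < t + 1, ¬ Deviates (fun l => (P i w l).2) (M.record w ω i) s :=
    Nat.forall_lt_succ_right.2 ⟨faithful i, h i⟩
  rcases Bool.eq_false_or_eq_true (M.operation w ω.toss t).1 with hpop | hpop
  · by_cases invalid : ∃ i, ¬ (M.faithfulQuery w ω t q' (l.headD M.blank)).1.Accepts i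
        (P i w (transcript (M.record w ω i) (t + 1))).2
    · obtain ⟨i, hi, hverdict⟩ := Query.receive_of_not_accepts trust hpop invalid
      refine .inr (.inr (hverdict.trans ?_))
      rcases hb i with honest | hclaim
      · refine absurd ?_ hi
        rw [honest, honestReply_transcript]
        rfl
      · rw [hclaim]
    · push Not at invalid
      have not_deviates (i : Bool) :
          ¬ Deviates (fun l => (P i w l).2) (M.record w ω i) t :=
        fun h => no_forgery i ⟨faithful i, h, invalid i⟩
      have correct (i : Bool) := not_and_not_right.1 (not_deviates i) hpop
      refine .inl ⟨⟨_, _, _, hc', ?_⟩, faithful_succ not_deviates⟩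
      rw [faithfulQuery_receive_of_pop trust hc' hpop correct]
  · refine .inl ⟨⟨_, _, _, hc', ?_⟩, faithful_succ fun i h => ?_⟩
    · rw [faithfulQuery_receive_of_not_pop trust _ hc hc' hpop]
    · exact Bool.false_ne_true (hpop.symm.trans h.1)

theorem synced_or_verdict
    (no_forgery : ∀ i, ∀ s < t, ¬ Forges (fun l => (P i w l).2) (M.record w ω i) (ω.key i) s)
    (hb : ∀ i, (∀ l, (P i w l).2 = honestReply d l) ∨ ∀ l, (trust && (P (!i) w l).1) = b) :
    M.Synced p trust P w ω t ∨
      (∃ b', M.config w ω.toss t = .halted b' ∧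
        (M.trace p trust P w ω t).state = State.verdict b') ∨
      (M.trace p trust P w ω t).state = State.verdict b := by
  induction t with
  | zero => exact .inl ⟨⟨_, _, _, rfl, rfl⟩, by simp⟩
  | succ t ih =>
    rcases ih fun i s hs => no_forgery i s (hs.trans t.lt_succ_self) with h | ⟨b', hc, ht⟩ | ht
    · exact h.succ (fun i => no_forgery i t t.lt_succ_self) hb
    · refine .inr (.inl ⟨b', config_succ_of_halted hc, ?_⟩)
      rw [trace, cycle_of_verdict P ht, ht]
    · refine .inr (.inr ?_)
      rw [trace, cycle_of_verdict P ht, ht]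

theorem toOuterMeasure_halted_le (n : ℕ)
    (hb : ∀ i, (∀ l, (P i w l).2 = honestReply d l) ∨ ∀ l, (trust && (P (!i) w l).1) = b) :
    (iid (coin p) n).toOuterMeasure {c | M.config w c n = .halted b} ≤
      ((M.verifier B p trust).run (P false) (P true) w (2 * n + 1)).toOuterMeasure
        {c | c.state = State.verdict b} + 2 * (Fintype.card B : ℝ≥0∞)⁻¹ := by
  let forgeries (i : Bool) : Set (Randomness Γ B) :=
    {ω | ∃ t ≤ n, Forges (fun l => (P i w l).2) (M.record w ω i) (ω.key i) t}
  let sound : Set (Randomness Γ B) := {ω | (M.trace p trust P w ω n).state = State.verdict b}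
  have subset : {ω : Randomness Γ B | M.config w ω.toss n = .halted b} ⊆
      sound ∪ (forgeries false ∪ forgeries true) := by
    intro ω hω
    by_contra h
    simp only [Set.mem_union, not_or] at h
    have no_forgery (i : Bool) : ∀ t < n,
        ¬ Forges (fun l => (P i w l).2) (M.record w ω i) (ω.key i) t := by
      intro t ht hforges
      cases i
      exacts [h.2.1 ⟨t, ht.le, hforges⟩, h.2.2 ⟨t, ht.le, hforges⟩]
    have halted : M.config w ω.toss n = .halted b := hω
    rcases synced_or_verdict no_forgery hb with ⟨⟨q, l, i, hc, -⟩, -⟩ | ⟨b', hc, ht⟩ | ht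
    · cases halted.symm.trans hc
    · cases halted.symm.trans hc
      exact h.1 ht
    · exact h.1 ht
  rw [run_eq_map_trace, ← randomnessLaw_map_toss (Γ := Γ) (B := B), PMF.toOuterMeasure_map_apply,
    PMF.toOuterMeasure_map_apply, two_mul]
  refine (MeasureTheory.measure_mono subset).trans ?_
  refine (MeasureTheory.measure_union_le _ _).trans (add_le_add_right ?_ _)
  exact (MeasureTheory.measure_union_le _ _).trans
    (add_le_add (randomnessLaw_forges_le _ _ _ _ _) (randomnessLaw_forges_le _ _ _ _ _))

end Synchronization

end Simulation

section Loops

variable {α : Type*} {Q Γ : Type} {M : QueueMachine α Q Γ} {w : List α} {c : ℕ → Bool} {t i : ℕ}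
  {q q' : Q} {x y : Γ} {l : List Γ}

theorem stay_guard_apply (a : TapeSymbol α) (i : ℕ) : (Move.stay.guard a).apply i = i := by
  cases a <;> rfl

theorem config_succ_of_push (h : M.config w c t = .running q (x :: l) i)
    (hδ : M.δ q x (tapeAt w i) (c t) = .proceed q' y false .stay) :
    M.config w c (t + 1) = .running q' (x :: (l ++ [y])) i := by
  rw [config_succ_of_proceed h hδ, stay_guard_apply]
  rfl

theorem config_succ_of_rotate (h : M.config w c t = .running q (x :: l) i)
    (hδ : M.δ q x (tapeAt w i) (c t) = .proceed q' y true .stay) :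
    M.config w c (t + 1) = .running q' (l ++ [y]) i := by
  rw [config_succ_of_proceed h hδ, stay_guard_apply]
  rfl

theorem config_add_of_push_loop {n : ℕ} (f : Fin (n + 1) → Q)
    (hδ : ∀ (j : Fin n) a b, M.δ (f j.succ) x a b = .proceed (f j.castSucc) y false .stay)
    (j : Fin (n + 1)) (h : M.config w c t = .running (f j) (x :: l) i) :
    M.config w c (t + j) = .running (f 0) (x :: (l ++ List.replicate j y)) i := by
  induction j using Fin.induction generalizing t l with
  | zero => simpa using h
  | succ j ih =>
    have := ih (config_succ_of_push h (hδ j _ _))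
    rwa [List.append_assoc, List.singleton_append, add_assoc, add_comm 1] at this

end Loops

end QueueMachine

section Index

variable {α : Type*} {k : ℕ} (code : α → Fin (k + 2))

/-- The number of the word `w`: its letters are digits to the base `k + 2`, after a leading digit
`1`. -/
def index (w : List α) : ℕ := w.foldl (fun N a => N * (k + 2) + code a) 1

theorem index_concat (w : List α) (a : α) :
    index code (w ++ [a]) = index code w * (k + 2) + code a := by
  simp [index]

theorem index_pos (w : List α) : 0 < index code w := by
  induction w using List.reverseRecOn with
  | nil => simp [index]
  | append_singleton w a ih => rw [index_concat]; positivity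

theorem index_concat_ne_one (w : List α) (a : α) : index code (w ++ [a]) ≠ 1 := by
  have := index_pos code w
  rw [index_concat]
  nlinarith

variable {code}

theorem index_injective (hcode : code.Injective) : (index code).Injective := by
  intro w w' h
  induction w using List.reverseRecOn generalizing w' with
  | nil =>
    rcases List.eq_nil_or_concat' w' with rfl | ⟨v, a, rfl⟩
    · rfl
    · exact absurd h.symm (index_concat_ne_one code v a)
  | append_singleton w a ih =>
    rcases List.eq_nil_or_concat' w' with rfl | ⟨v, a', rfl⟩
    · exact absurd h (index_concat_ne_one code w a)
    · rw [index_concat, index_concat] at h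
      have last_eq : code a = code a' := Fin.ext <| by
        simpa only [Nat.mul_add_mod_of_lt (code _).isLt] using congrArg (· % (k + 2)) h
      rw [last_eq] at h
      rw [ih (Nat.eq_of_mul_eq_mul_right (by simp) (Nat.add_right_cancel h)), hcode last_eq]

end Index

/-- A cell for one digit of each of two counters, to the base 4. -/
structure Cell where
  /-- whether this digit belongs to the block of the highest digits -/
  isHigh : Bool
  /-- the digit of the number of heads -/
  heads : Fin 4
  /-- the digit of the number of tosses -/
  tosses : Fin 4
  deriving DecidableEq, Fintype

/-- The control states of the decoder: append `j` low cells; append `d` high cells and read the next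
letter, or make `i` more copies of the front cell; increment the counters, with their carries;
look for the first high cell. -/
inductive Ctl (k m : ℕ) where
  | init (j : Fin (m + 3))
  | load (d i : Fin (k + 2))
  | count (headsCarry tossesCarry : Bool)
  | search
  deriving Fintype

/-- A cell with zero digits. -/
def zeroCell (high : Bool) : Cell := ⟨high, 0, 0⟩

/-- Add the carries to the digits in a cell. -/
def Cell.incr (x : Cell) (headsCarry tossesCarry : Bool) : Cell where
  isHigh := x.isHigh
  heads := if headsCarry then x.heads + 1 else x.heads
  tosses := if tossesCarry then x.tosses + 1 else x.tosses

/-- The queue machine that computes the index `N` of the input in unary, as the number of high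
cells, counts heads among as many coin tosses as the cells can count, and tests whether the `N`-th
highest digit of the result is `2`. The symbol `none` marks the beginning of the counters, lowest
digit first. -/
def decoder {α : Type*} {k : ℕ} (m : ℕ) (code : α → Fin (k + 2)) :
    QueueMachine α (Ctl k m) (Option Cell) where
  start := .init (Fin.last _)
  blank := none
  δ q x a c :=
    match q, x with
    | .init j, _ =>
      Fin.cases (.proceed (.load 0 (Fin.last _)) (some (zeroCell true)) false .stay)
        (fun j => .proceed (.init j.castSucc) (some (zeroCell false)) false .stay) j
    | .load d i, some x =>
      Fin.cases (.proceed (.load d (Fin.last _)) (some x) true .stay)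
        (fun i => .proceed (.load d i.castSucc) (some x) false .stay) i
    | .load d i, none =>
      Fin.cases
        (match a with
          | .leftEnd => .halt false
          | .letter b => .proceed (.load (code b) i) none true .right
          | .rightEnd => .proceed (.count c true) none true .stay)
        (fun d => .proceed (.load d.castSucc i) (some (zeroCell true)) false .stay) d
    | .count h t, some x =>
      .proceed (.count (h && x.heads = 3) (t && x.tosses = 3)) (some (x.incr h t)) true .stay
    | .count _ t, none => .proceed (if t then .search else .count c true) none true .stay
    | .search, some x =>
      if x.isHigh then .halt (x.heads = 2) else .proceed .search (some x) true .stay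
    | .search, none => .halt false

section Load

variable {α : Type*} {k m : ℕ} {code : α → Fin (k + 2)} {w : List α} {c : ℕ → Bool} {t i : ℕ}

theorem decoder_copy {d : Fin (k + 2)} {x : Cell} {l : List (Option Cell)}
    (h : (decoder m code).config w c t = .running (.load d (Fin.last _)) (some x :: l) i) :
    (decoder m code).config w c (t + (k + 2)) =
      .running (.load d (Fin.last _)) (l ++ List.replicate (k + 2) (some x)) i := by
  have := QueueMachine.config_succ_of_rotate
    (QueueMachine.config_add_of_push_loop (Ctl.load d) (fun _ _ _ => rfl) _ h) rfl
  simpa [List.replicate_succ', add_assoc] using this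

theorem decoder_copies {d : Fin (k + 2)} {x : Cell} (a : ℕ) {l : List (Option Cell)}
    (h : (decoder m code).config w c t =
      .running (.load d (Fin.last _)) (List.replicate a (some x) ++ l) i) :
    (decoder m code).config w c (t + a * (k + 2)) =
      .running (.load d (Fin.last _)) (l ++ List.replicate (a * (k + 2)) (some x)) i := by
  induction a generalizing t l with
  | zero => simpa using h
  | succ a ih =>
    have := ih (t := t + (k + 2)) (by simpa using decoder_copy h)
    simpa [add_one_mul, add_assoc, add_comm, add_left_comm] using this

/-- The counters with `a` low and `N` high cells while the input is being loaded. -/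
def zeroCells (a N : ℕ) : List Cell :=
  List.replicate a (zeroCell false) ++ List.replicate N (zeroCell true)

theorem decoder_load_letter {b : α} {a N : ℕ} (hb : tapeAt w i = TapeSymbol.letter b)
    (h : (decoder m code).config w c t =
      .running (.load 0 (Fin.last _)) (none :: (zeroCells a N).map some) i) :
    (decoder m code).config w c (t + 1 + a * (k + 2) + N * (k + 2) + code b) =
      .running (.load 0 (Fin.last _))
        (none :: (zeroCells (a * (k + 2)) (N * (k + 2) + code b)).map some) (i + 1) := by
  have read := QueueMachine.config_succ_of_proceed (q' := .load (code b) (Fin.last _)) (y := none)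
    (pop := true) (v := .right) h (by rw [hb]; rfl)
  rw [hb] at read
  have low := decoder_copies (x := zeroCell false) (l := List.replicate N (some (zeroCell true)) ++
    [none]) a (by simpa [zeroCells] using read)
  have high := decoder_copies (x := zeroCell true) (l := [none] ++
    List.replicate (a * (k + 2)) (some (zeroCell false))) N (by simpa using low)
  have grow := QueueMachine.config_add_of_push_loop (y := some (zeroCell true))
    (x := none) (l := ((zeroCells (a * (k + 2)) (N * (k + 2))).map some))
    (fun d => Ctl.load d (Fin.last _)) (fun _ _ _ => rfl) (code b)
    (by simpa [zeroCells] using high)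
  simpa [zeroCells, List.replicate_append_replicate, Move.guard, Move.apply] using grow

theorem tapeAt_length_add_one : tapeAt w (w.length + 1) = TapeSymbol.rightEnd := by
  simp [tapeAt]

theorem decoder_load (m : ℕ) (code : α → Fin (k + 2)) (w : List α) :
    ∃ t a, index code w + m + 1 ≤ a ∧ ∀ c, (decoder m code).config w c t =
      .running (.load 0 (Fin.last _)) (none :: (zeroCells a (index code w)).map some)
        (w.length + 1) := by
  suffices prefixes : ∀ j ≤ w.length, ∃ t a, index code (w.take j) + m + 1 ≤ a ∧
      ∀ c, (decoder m code).config w c t = .running (.load 0 (Fin.last _))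
        (none :: (zeroCells a (index code (w.take j))).map some) (j + 1) by
    simpa using prefixes w.length le_rfl
  intro j hj
  induction j with
  | zero =>
    refine ⟨0 + (m + 2) + 1, m + 2, by simp [index]; omega, fun c => ?_⟩
    have := QueueMachine.config_succ_of_push (QueueMachine.config_add_of_push_loop
      (M := decoder m code) (w := w) (c := c) (y := some (zeroCell false)) (t := 0) Ctl.init
      (fun _ _ _ => rfl) (Fin.last _) rfl) rfl
    simpa [zeroCells, index, decoder] using this
  | succ j ih =>
    obtain ⟨t, a, ha, h⟩ := ih (Nat.le_of_succ_le hj)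
    have index_succ : index code (w.take (j + 1)) =
        index code (w.take j) * (k + 2) + code w[j] := by
      rw [← List.take_concat_get' w j hj, index_concat]
    have letter : tapeAt w (j + 1) = TapeSymbol.letter w[j] := by
      simp [tapeAt, Nat.lt_of_succ_le hj]
    rw [index_succ]
    refine ⟨_, _, ?_, fun c => decoder_load_letter letter (h c)⟩
    have := (code w[j]).isLt
    nlinarith

end Load

section Digits

/-- The number whose digits to the base 4, lowest first, are selected from the cells by `f`. -/
def value (f : Cell → Fin 4) (u : List Cell) : ℕ := Nat.ofDigits 4 (u.map fun x => (f x : ℕ))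

variable (f : Cell → Fin 4)

theorem value_cons (x : Cell) (u : List Cell) : value f (x :: u) = f x + 4 * value f u := by
  simp [value, Nat.ofDigits_cons]

theorem value_append (u v : List Cell) :
    value f (u ++ v) = value f u + 4 ^ u.length * value f v := by
  simp [value, Nat.ofDigits_append]

theorem value_lt (u : List Cell) : value f u < 4 ^ u.length := by
  have := Nat.ofDigits_lt_base_pow_length (b := 4) (l := u.map fun x => (f x : ℕ)) (by norm_num)
    (by simp only [List.mem_map]; rintro _ ⟨x, -, rfl⟩; exact (f x).isLt)
  simpa [value] using this

theorem value_replicate_of_eq_zero {f : Cell → Fin 4} {x : Cell} (hx : f x = 0) (n : ℕ) :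
    value f (List.replicate n x) = 0 := by
  induction n with
  | zero => rfl
  | succ n ih => rw [List.replicate_succ, value_cons, hx, ih]; rfl

theorem value_zeroCells {f : Cell → Fin 4} (hf : ∀ high, f (zeroCell high) = 0) (a N : ℕ) :
    value f (zeroCells a N) = 0 := by
  rw [zeroCells, value_append, value_replicate_of_eq_zero (hf _),
    value_replicate_of_eq_zero (hf _), mul_zero, add_zero]

theorem value_append_cons_div_mod (u : List Cell) (x : Cell) (v : List Cell) :
    value f (u ++ x :: v) / 4 ^ u.length % 4 = f x := by
  rw [value_append, Nat.add_mul_div_left _ _ (by positivity), Nat.div_eq_of_lt (value_lt f u),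
    zero_add, value_cons, Nat.add_mul_mod_self_left, Nat.mod_eq_of_lt (f x).isLt]

theorem digit_add_carry (carry : Bool) (x : Fin 4) :
    ((if carry then x + 1 else x : Fin 4) : ℕ) + 4 * (carry && x = 3 : Bool).toNat =
      x + carry.toNat := by
  revert carry x
  decide

theorem value_cons_add_carry {u u' : List Cell} {x x' : Cell} {h h' : Bool}
    (hx : f x' = if h then f x + 1 else f x)
    (hu : value f u' + 4 ^ u.length * h'.toNat =
      value f u + (h && f x = 3 : Bool).toNat) :
    value f (x' :: u') + 4 ^ (x :: u).length * h'.toNat = value f (x :: u) + h.toNat := by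
  have digit := digit_add_carry h (f x)
  rw [← hx] at digit
  rw [value_cons, value_cons, List.length_cons, pow_succ]
  linear_combination digit + 4 * hu

end Digits

/-- The number of heads among the coin tosses at the times in `I`. -/
def headsCount (I : Finset ℕ) (c : ℕ → Bool) : ℕ := ∑ i ∈ I, (c i).toNat

/-- The times of `g` coin tosses, starting at `t`, with `ℓ` steps between consecutive ones. -/
def tossTimes (t ℓ g : ℕ) : Finset ℕ := (Finset.range g).image fun j => t + j * (ℓ + 1)

theorem tossTimes_injective (t ℓ : ℕ) : (fun j => t + j * (ℓ + 1)).Injective :=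
  (add_right_injective t).comp (mul_left_injective₀ ℓ.succ_ne_zero)

theorem card_tossTimes (t ℓ g : ℕ) : (tossTimes t ℓ g).card = g := by
  rw [tossTimes, Finset.card_image_of_injective _ (tossTimes_injective t ℓ), Finset.card_range]

theorem tossTimes_subset_range (t ℓ g : ℕ) : tossTimes t ℓ g ⊆ Finset.range (t + g * (ℓ + 1)) := by
  intro s hs
  obtain ⟨j, hj, rfl⟩ := Finset.mem_image.1 hs
  have := Nat.mul_lt_mul_of_pos_right (Finset.mem_range.1 hj) ℓ.succ_pos
  exact Finset.mem_range.2 (Nat.add_lt_add_left this t)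

theorem headsCount_tossTimes_succ (t ℓ g : ℕ) (c : ℕ → Bool) :
    headsCount (tossTimes t ℓ (g + 1)) c =
      headsCount (tossTimes t ℓ g) c + (c (t + g * (ℓ + 1))).toNat := by
  simp only [headsCount, tossTimes, Finset.sum_image (tossTimes_injective t ℓ).injOn,
    Finset.sum_range_succ]

section Count

variable {α : Type*} {k m : ℕ} {code : α → Fin (k + 2)} {w : List α} {c : ℕ → Bool} {t i : ℕ}

theorem decoder_pass {u : List Cell} {v : List (Option Cell)} {h b : Bool}
    (hc : (decoder m code).config w c t = .running (.count h b) (u.map some ++ v) i) :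
    ∃ u' h' b', (decoder m code).config w c (t + u.length) =
        .running (.count h' b') (v ++ u'.map some) i ∧
      u'.map Cell.isHigh = u.map Cell.isHigh ∧
      value Cell.heads u' + 4 ^ u.length * h'.toNat = value Cell.heads u + h.toNat ∧
      value Cell.tosses u' + 4 ^ u.length * b'.toNat = value Cell.tosses u + b.toNat := by
  induction u generalizing v h b t with
  | nil => exact ⟨[], h, b, by simpa using hc, rfl, by simp [value], by simp [value]⟩
  | cons x u ih =>
    obtain ⟨u', h', b', config_eq, isHigh_eq, heads_eq, tosses_eq⟩ :=
      ih (v := v ++ [_]) (by simpa using QueueMachine.config_succ_of_rotate hc rfl)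
    refine ⟨x.incr h b :: u', h', b', ?_, ?_, ?_, ?_⟩
    · simpa [add_assoc, add_comm 1] using config_eq
    · simp [isHigh_eq, Cell.incr]
    · exact value_cons_add_carry Cell.heads rfl heads_eq
    · exact value_cons_add_carry Cell.tosses rfl tosses_eq

theorem decoder_round {u : List Cell} {h : Bool}
    (hc : (decoder m code).config w c t = .running (.count h true) (u.map some ++ [none]) i) :
    ∃ u' h', (decoder m code).config w c (t + u.length) =
        .running (.count h' (value Cell.tosses u + 1 = 4 ^ u.length)) (none :: u'.map some) i ∧
      u'.map Cell.isHigh = u.map Cell.isHigh ∧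
      value Cell.heads u' ≡ value Cell.heads u + h.toNat [MOD 4 ^ u.length] ∧
      value Cell.tosses u' ≡ value Cell.tosses u + 1 [MOD 4 ^ u.length] := by
  obtain ⟨u', h', b', config_eq, isHigh_eq, heads_eq, tosses_eq⟩ := decoder_pass hc
  have length_eq : u'.length = u.length := by simpa using congrArg List.length isHigh_eq
  have overflow : b' = decide (value Cell.tosses u + 1 = 4 ^ u.length) := by
    have lt := value_lt Cell.tosses u
    have lt' := value_lt Cell.tosses u'
    rw [length_eq] at lt'
    cases b' <;> simp only [Bool.toNat_true, Bool.toNat_false] at tosses_eq <;> symm <;>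
      simp only [decide_eq_true_eq, decide_eq_false_iff_not] <;> omega
  refine ⟨u', h', overflow ▸ config_eq, isHigh_eq, ?_, ?_⟩
  · rw [← heads_eq]
    simp [Nat.ModEq]
  · rw [← Bool.toNat_true, ← tosses_eq]
    simp [Nat.ModEq]

theorem decoder_count {a N ℓ g : ℕ} (hℓ : a + N = ℓ) (hg : g ≤ 4 ^ ℓ)
    (hc : (decoder m code).config w c t =
      .running (.load 0 (Fin.last _)) (none :: (zeroCells a N).map some) (w.length + 1)) :
    ∃ q u, (decoder m code).config w c (t + g * (ℓ + 1)) =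
        .running q (none :: u.map some) (w.length + 1) ∧
      (∀ b, (decoder m code).δ q none .rightEnd b =
        .proceed (if g = 4 ^ ℓ then .search else .count b true) none true .stay) ∧
      u.map Cell.isHigh = (zeroCells a N).map Cell.isHigh ∧
      value Cell.heads u ≡ headsCount (tossTimes t ℓ g) c [MOD 4 ^ ℓ] ∧
      value Cell.tosses u ≡ g [MOD 4 ^ ℓ] := by
  induction g with
  | zero =>
    refine ⟨_, _, by simpa using hc, fun b => ?_, rfl, ?_, ?_⟩
    · rw [if_neg (by positivity)]
      rfl
    · rw [value_zeroCells fun _ => rfl]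
      rfl
    · rw [value_zeroCells fun _ => rfl]
  | succ g ih =>
    obtain ⟨q, u, config_eq, hq, isHigh_eq, heads_eq, tosses_eq⟩ := ih (Nat.le_of_succ_le hg)
    have length_eq : u.length = ℓ := by
      simpa [zeroCells, hℓ] using congrArg List.length isHigh_eq
    have tosses_eq : value Cell.tosses u = g :=
      Nat.ModEq.eq_of_lt_of_lt tosses_eq (length_eq ▸ value_lt _ u) hg
    obtain ⟨u', h', config_eq', isHigh_eq', heads_eq', tosses_eq'⟩ :=
      decoder_round (QueueMachine.config_succ_of_rotate config_eq
        (by rw [tapeAt_length_add_one, hq, if_neg (Nat.ne_of_lt hg)]))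
    rw [length_eq, tosses_eq] at config_eq'
    rw [length_eq] at heads_eq' tosses_eq'
    refine ⟨_, u', by rw [← config_eq']; congr 1; ring, fun b => ?_, isHigh_eq'.trans isHigh_eq,
      ?_, tosses_eq ▸ tosses_eq'⟩
    · by_cases last : g + 1 = 4 ^ ℓ <;> simp [decoder, last]
    · rw [headsCount_tossTimes_succ]
      exact heads_eq'.trans (heads_eq.add_right _)

theorem decoder_search {u : List Cell} {x : Cell} {l : List (Option Cell)}
    (hu : ∀ y ∈ u, y.isHigh = false) (hx : x.isHigh = true)
    (hc : (decoder m code).config w c t = .running .search (u.map some ++ some x :: l) i) :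
    (decoder m code).config w c (t + u.length + 1) = .halted (x.heads = 2) := by
  induction u generalizing t l with
  | nil => exact QueueMachine.config_succ_of_halt hc (by simp [decoder, hx])
  | cons y u ih =>
    have rotate := QueueMachine.config_succ_of_rotate (q' := .search) (y := some y) hc
      (by simp [decoder, hu y])
    rw [List.length_cons, add_comm u.length, ← add_assoc]
    exact ih (l := l ++ [some y]) (fun z hz => hu z (by simp [hz])) (by simpa using rotate)

theorem exists_split_of_map_isHigh_eq {u : List Cell} {a N : ℕ}
    (hu : u.map Cell.isHigh = (zeroCells a (N + 1)).map Cell.isHigh) :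
    ∃ v x v', u = v ++ x :: v' ∧ v.length = a ∧ (∀ y ∈ v, y.isHigh = false) ∧ x.isHigh = true := by
  simp only [zeroCells, zeroCell, List.replicate_succ, List.map_append, List.map_cons,
    List.map_replicate] at hu
  obtain ⟨v, v', rfl, low, high⟩ := List.map_eq_append_iff.1 hu
  obtain ⟨x, v', rfl, hx, -⟩ := List.map_eq_cons_iff.1 high
  refine ⟨v, x, v', rfl, by simpa using congrArg List.length low, fun y hy => ?_, hx⟩
  exact List.eq_of_mem_replicate (low ▸ List.mem_map_of_mem hy)

theorem div_mod_eq_of_modEq {a ℓ x y : ℕ} (ha : a < ℓ) (h : x ≡ y [MOD 4 ^ ℓ]) :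
    x / 4 ^ a % 4 = y / 4 ^ a % 4 := by
  have : x ≡ y [MOD 4 ^ a * 4] := h.of_dvd (pow_succ 4 a ▸ pow_dvd_pow 4 ha)
  rw [← Nat.mod_mul_right_div_self, ← Nat.mod_mul_right_div_self, this]

theorem decoder_verdict {a N ℓ : ℕ} (hℓ : a + (N + 1) = ℓ)
    (hc : (decoder m code).config w c t =
      .running (.load 0 (Fin.last _)) (none :: (zeroCells a (N + 1)).map some) (w.length + 1)) :
    (decoder m code).config w c (t + 4 ^ ℓ * (ℓ + 1) + 1 + a + 1) =
      .halted (headsCount (tossTimes t ℓ (4 ^ ℓ)) c / 4 ^ a % 4 = 2) := by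
  obtain ⟨q, u, config_eq, hq, isHigh_eq, heads_eq, -⟩ := decoder_count hℓ le_rfl hc
  obtain ⟨v, x, v', rfl, length_eq, low, high⟩ := exists_split_of_map_isHigh_eq isHigh_eq
  have start := QueueMachine.config_succ_of_rotate config_eq
    (by rw [tapeAt_length_add_one, hq, if_pos rfl])
  have halt := decoder_search (l := v'.map some ++ [none]) low high (by simpa using start)
  have digit := value_append_cons_div_mod Cell.heads v x v'
  rw [length_eq] at halt digit
  rw [halt, ← div_mod_eq_of_modEq (by omega) heads_eq, digit]
  simp only [Fin.ext_iff, Fin.coe_ofNat_eq_mod]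

theorem exists_config_decoder_eq_halted (m : ℕ) (code : α → Fin (k + 2)) (w : List α) :
    ∃ n I a, index code w + m + 1 ≤ a ∧ I ⊆ Finset.range n ∧
      I.card = 4 ^ (a + index code w) ∧
      ∀ c, (decoder m code).config w c n = .halted (headsCount I c / 4 ^ a % 4 = 2) := by
  obtain ⟨t, a, ha, load⟩ := decoder_load m code w
  obtain ⟨N, hN⟩ := Nat.exists_eq_add_one.2 (index_pos code w)
  obtain ⟨ℓ, hℓ⟩ : ∃ ℓ, a + (N + 1) = ℓ := ⟨_, rfl⟩
  rw [hN] at ha load ⊢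
  refine ⟨t + 4 ^ ℓ * (ℓ + 1) + 1 + a + 1, tossTimes t ℓ (4 ^ ℓ), a, ha, ?_, ?_,
    fun c => decoder_verdict hℓ (load c)⟩
  · exact (tossTimes_subset_range _ _ _).trans (Finset.range_mono (by omega))
  · rw [card_tossTimes, hℓ]

end Count

section Encoding

theorem mul_ofDigits {b : ℕ} [NeZero b] (d : ℕ → Fin b) :
    b * Real.ofDigits d = d 0 + Real.ofDigits fun i => d (i + 1) := by
  have hb : (b : ℝ) ≠ 0 := NeZero.ne _
  rw [Real.ofDigits_eq_sum_add_ofDigits d 1, Finset.sum_range_one, Real.ofDigitsTerm]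
  field_simp
  ring

theorem exists_pow_mul_ofDigits {b : ℕ} [NeZero b] (d : ℕ → Fin b) (n : ℕ) :
    ∃ k : ℕ, (b : ℝ) ^ n * Real.ofDigits d = k + Real.ofDigits fun i => d (i + n) := by
  induction n with
  | zero => exact ⟨0, by simp⟩
  | succ n ih =>
    obtain ⟨k, hk⟩ := ih
    have tail := mul_ofDigits fun i => d (i + n)
    simp only [zero_add, add_right_comm] at tail
    refine ⟨b * k + d n, ?_⟩
    push_cast
    rw [pow_succ']
    linear_combination b * hk + tail

theorem ofDigits_mem_Icc {d : ℕ → Fin 4} (hd : d 0 = 1 ∨ d 0 = 2) :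
    Real.ofDigits d ∈ Set.Icc (1 / 4) (3 / 4) := by
  have leading := mul_ofDigits d
  have tail_nonneg := Real.ofDigits_nonneg fun i => d (i + 1)
  have tail_le_one := Real.ofDigits_le_one fun i => d (i + 1)
  rcases hd with hd | hd <;> norm_num [hd] at leading <;> constructor <;> linarith

/-- Since the digit after `d n` is `1` or `2`, an error of a quarter of a unit of `d n` produces no
carry into `d n`. -/
theorem div_pow_mod_eq_digit {d : ℕ → Fin 4} {n : ℕ} (hd : d (n + 1) = 1 ∨ d (n + 1) = 2)
    {H a : ℕ} (h : |(H : ℝ) - Real.ofDigits d * 4 ^ (a + (n + 1))| < 4 ^ a / 4) :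
    H / 4 ^ a % 4 = d n := by
  obtain ⟨k, hk⟩ := exists_pow_mul_ofDigits d n
  have leading := mul_ofDigits fun i => d (i + n)
  simp only [zero_add, add_right_comm _ 1 n, add_assoc _ n 1] at leading
  obtain ⟨tail_ge, tail_le⟩ := ofDigits_mem_Icc (d := fun i => d (i + (n + 1))) (by simpa using hd)
  set x := Real.ofDigits fun i => d (i + (n + 1))
  have expand : Real.ofDigits d * 4 ^ (a + (n + 1)) = ((4 * k + d n : ℕ) + x) * 4 ^ a := by
    push_cast at hk leading ⊢
    linear_combination 4 * 4 ^ a * hk + 4 ^ a * leading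
  have pos : (0 : ℝ) < 4 ^ a := by positivity
  rw [expand, abs_lt] at h
  have quotient : H / 4 ^ a = 4 * k + d n := by
    apply Nat.div_eq_of_lt_le
    · have : ((4 * k + d n : ℕ) : ℝ) * 4 ^ a ≤ H := by nlinarith
      exact_mod_cast this
    · have : (H : ℝ) < ((4 * k + d n : ℕ) + 1) * 4 ^ a := by nlinarith
      exact_mod_cast this
  rw [quotient, Nat.mul_add_mod, Nat.mod_eq_of_lt (d n).isLt]

theorem headsDeviation_eq (p : ℝ) (I : Finset ℕ) (c : ℕ → Bool) :
    headsDeviation p I c = headsCount I c - p * I.card := by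
  simp [headsDeviation, headsCount, mul_comm p]

end Encoding

section Main

variable {α : Type*} {k : ℕ} {code : α → Fin (k + 2)} {L : Language α}

open Classical in
/-- The base-4 digits, all of them `1` or `2`, that encode the membership in the language `L`. -/
noncomputable def languageDigit (code : α → Fin (k + 2)) (L : Language α) (n : ℕ) : Fin 4 :=
  if ∃ w ∈ L, index code w = n + 1 then 2 else 1

theorem languageDigit_eq_one_or_two (n : ℕ) :
    languageDigit code L n = 1 ∨ languageDigit code L n = 2 := by
  rw [languageDigit]
  split_ifs <;> simp

theorem languageDigit_eq_two_iff (hcode : code.Injective) {w : List α} {n : ℕ}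
    (hn : index code w = n + 1) : languageDigit code L n = 2 ↔ w ∈ L := by
  have : (∃ w' ∈ L, index code w' = n + 1) ↔ w ∈ L := by
    simp only [← hn, (index_injective hcode).eq_iff, exists_eq_right]
  simp only [languageDigit, this]
  split_ifs with hw <;> simp [← this, hw]

/-- The bias of the coin that encodes the language `L`. -/
noncomputable def languageBias (code : α → Fin (k + 2)) (L : Language α) : unitInterval :=
  ⟨Real.ofDigits (languageDigit code L), Real.ofDigits_nonneg _, Real.ofDigits_le_one _⟩

theorem iid_coin_deviation_le (p : unitInterval) {m n a N : ℕ} {I : Finset ℕ} (ha : N + m + 1 ≤ a)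
    (hI : I ⊆ Finset.range n) (hcard : I.card = 4 ^ (a + N)) :
    (iid (coin p) n).toOuterMeasure {c | (4 : ℝ) ^ a / 4 ≤ |headsDeviation p I c|} ≤
      ENNReal.ofReal (4 / 4 ^ m) := by
  refine (toOuterMeasure_le_abs_headsDeviation_le p hI (by positivity)).trans
    (ENNReal.ofReal_le_ofReal ?_)
  rw [div_le_div_iff₀ (by positivity) (by positivity), hcard]
  push_cast
  calc (4 : ℝ) ^ (a + N) * 4 ^ m = 4 ^ a * 4 ^ (N + m + 1) / 4 := by ring
    _ ≤ 4 ^ a * 4 ^ a / 4 := by gcongr; norm_num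
    _ = 4 * (4 ^ a / 4) ^ 2 := by ring

open Classical in
theorem one_le_decoder_decides (m : ℕ) (hcode : code.Injective) (L : Language α) (w : List α) :
    ∃ n, 1 ≤ (iid (coin (languageBias code L)) n).toOuterMeasure
        {c | (decoder m code).config w c n = .halted (decide (w ∈ L))} +
      ENNReal.ofReal (4 / 4 ^ m) := by
  obtain ⟨n, I, a, ha, hI, hcard, verdict⟩ := exists_config_decoder_eq_halted m code w
  obtain ⟨N, hN⟩ := Nat.exists_eq_add_one.2 (index_pos code w)
  refine ⟨n, ?_⟩
  set μ := (iid (coin (languageBias code L)) n).toOuterMeasure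
  have correct (c : ℕ → Bool) (hc : |headsDeviation (languageBias code L) I c| < 4 ^ a / 4) :
      (decoder m code).config w c n = .halted (decide (w ∈ L)) := by
    rw [headsDeviation_eq, hcard, hN, Nat.cast_pow] at hc
    rw [verdict, div_pow_mod_eq_digit (languageDigit_eq_one_or_two _) hc]
    simp only [← languageDigit_eq_two_iff hcode hN, Fin.ext_iff]
    rfl
  calc 1 = μ Set.univ := ((PMF.toOuterMeasure_apply_eq_one_iff _ _).2 (Set.subset_univ _)).symm
    _ ≤ μ ({c | (decoder m code).config w c n = .halted (decide (w ∈ L))} ∪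
        {c | (4 : ℝ) ^ a / 4 ≤ |headsDeviation (languageBias code L) I c|}) :=
      MeasureTheory.measure_mono fun c _ => (lt_or_ge _ _).imp (correct c) id
    _ ≤ _ := MeasureTheory.measure_union_le _ _
    _ ≤ _ := add_le_add_right (iid_coin_deviation_le _ ha hI hcard) _

open Classical in
theorem decidesCorrectly_verifier_decoder {B : Type} [Fintype B] [DecidableEq B]
    [AddCommGroup B] (hcode : code.Injective) {m : ℕ} {ε : ℝ} (hε : 0 ≤ ε)
    (hm : 4 / 4 ^ m ≤ ε / 2) (hB : 2 * (Fintype.card B : ℝ)⁻¹ ≤ ε / 2) (trust : Bool)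
    (d : Record (Option Cell × B) B) (P : Bool → Prover α (Record (Option Cell × B) B))
    {w : List α}
    (hP : ∀ i, (∀ l, (P i w l).2 = honestReply d l) ∨
      ∀ l, (trust && (P (!i) w l).1) = decide (w ∈ L)) :
    ((decoder m code).verifier B (languageBias code L) trust).DecidesCorrectly L ε
      (P false) (P true) w := by
  suffices verdict : ENNReal.ofReal (1 - ε) ≤
      ⨆ n, (((decoder m code).verifier B (languageBias code L) trust).run (P false) (P true) w
        n).toOuterMeasure {c | c.state = State.verdict (decide (w ∈ L))} by
    constructor <;> intro hw <;>
      simpa [hw, State.verdict, Verifier.acceptProb, Verifier.rejectProb] using verdict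
  obtain ⟨n, hn⟩ := one_le_decoder_decides m hcode L w
  refine le_trans ?_ (le_iSup _ (2 * n + 1))
  have forgery : 2 * (Fintype.card B : ℝ≥0∞)⁻¹ ≤ ENNReal.ofReal (ε / 2) := by
    have card_pos : (0 : ℝ) < Fintype.card B := by exact_mod_cast Fintype.card_pos
    refine le_of_eq_of_le ?_ (ENNReal.ofReal_le_ofReal hB)
    rw [ENNReal.ofReal_mul zero_le_two, ENNReal.ofReal_inv_of_pos card_pos,
      ENNReal.ofReal_natCast, ENNReal.ofReal_ofNat]
  rw [ENNReal.ofReal_sub _ hε, ENNReal.ofReal_one, tsub_le_iff_right]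
  refine hn.trans ((add_le_add
    (QueueMachine.toOuterMeasure_halted_le n hP) (ENNReal.ofReal_le_ofReal hm)).trans ?_)
  rw [add_assoc]
  gcongr
  refine (add_le_add_left forgery _).trans ?_
  rw [← ENNReal.ofReal_add (by positivity) (by positivity), add_halves]

open Classical in
/-- The honest strategy: announce the membership of the input in `L`, and store the queue. -/
noncomputable def honestProver {X B : Type} (L : Language α) (d : Record X B) :
    Prover α (Record X B) :=
  fun w l => (decide (w ∈ L), honestReply d l)

theorem exists_parameters (α : Type*) [Finite α] {ε : ℝ} (hε : 0 < ε) :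
    ∃ (k : ℕ) (code : α → Fin (k + 2)) (m q : ℕ), code.Injective ∧ 4 / 4 ^ m ≤ ε / 2 ∧
      2 * (Fintype.card (ZMod (q + 1)) : ℝ)⁻¹ ≤ ε / 2 := by
  obtain ⟨k, ⟨e⟩⟩ := Finite.exists_equiv_fin α
  obtain ⟨m, hm⟩ := exists_pow_lt_of_lt_one (show 0 < ε / 8 by positivity)
    (show (1 / 4 : ℝ) < 1 by norm_num)
  obtain ⟨q, hq⟩ := exists_nat_one_div_lt (show 0 < ε / 4 by positivity)
  refine ⟨k, fun a => (e a).castAdd 2, m, q,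
    (Fin.castAdd_injective k 2).comp e.injective, ?_, ?_⟩
  · rw [one_div, inv_pow] at hm
    rw [div_eq_mul_inv]
    linarith
  · rw [ZMod.card, ← one_div]
    push_cast
    linarith

theorem exists_verifiesMultiProver {α : Type*} [Finite α] (L : Language α) {ε : ℝ} (hε : 0 < ε) :
    ∃ V : Verifier α, V.VerifiesMultiProver L ε := by
  obtain ⟨k, code, m, q, hcode, hm, hq⟩ := exists_parameters α hε
  have correct := decidesCorrectly_verifier_decoder (L := L) hcode hε.le hm hq false default
  let P := honestProver L (default : Record (Option Cell × ZMod (q + 1)) (ZMod (q + 1)))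
  refine ⟨(decoder m code).verifier (ZMod (q + 1)) (languageBias code L) false,
    ⟨P, P, fun w hw => ?_⟩, fun w hw P₁ P₂ => ?_⟩
  · exact (correct (fun _ => P) fun _ => .inl fun _ => rfl).1 hw
  · exact (correct (cond · P₂ P₁) fun i => .inr fun _ => by simp [hw]).2 hw

theorem exists_verifiesNoisyOracle {α : Type*} [Finite α] (L : Language α) {ε : ℝ} (hε : 0 < ε) :
    ∃ V : Verifier α, V.VerifiesNoisyOracle L ε := by
  obtain ⟨k, code, m, q, hcode, hm, hq⟩ := exists_parameters α hε
  have correct := decidesCorrectly_verifier_decoder (L := L) hcode hε.le hm hq true default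
  let P := honestProver L (default : Record (Option Cell × ZMod (q + 1)) (ZMod (q + 1)))
  refine ⟨(decoder m code).verifier (ZMod (q + 1)) (languageBias code L) true, P, P,
    fun w => ⟨fun P₂ => correct (cond · P₂ P) ?_, fun P₁ => correct (cond · P P₁) ?_⟩⟩
  · exact Bool.forall_bool.2 ⟨.inl fun _ => rfl, .inr fun _ => rfl⟩
  · exact Bool.forall_bool.2 ⟨.inr fun _ => rfl, .inl fun _ => rfl⟩

end Main

end TwoProverIPS

theorem theorem5 {α : Type*} [Finite α] (L : Language α) (ε : ℝ) (hε : 0 < ε)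
    (hε' : ε < 1 / 2) :
    (∃ V : TwoProverIPS.Verifier α, V.VerifiesMultiProver L ε) ∧
      (∃ V : TwoProverIPS.Verifier α, V.VerifiesNoisyOracle L ε) :=
  ⟨TwoProverIPS.exists_verifiesMultiProver L hε, TwoProverIPS.exists_verifiesNoisyOracle L hε⟩
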